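/- Let $k$ be an algebraically closed field of characteristic zero and let $G=\operatorname{Spec}A$ be an abelian affine $k$-group, i.e. $A$ is a commutative and cocommutative Hopf algebra over $k$ and $G$ is the functor of groups $B\mapsto \operatorname{Hom}_{k\text{-alg}}(A,B)$ on commutative $k$-algebras. A linear representation of $G$ means an $A$-comodule. (1) There exist a set $X$ and a diagonalizable affine $k$-group $D$ (every linear representation of $D$ is a direct sum of subrepresentations of rank $1$) together with an isomorphism of $k$-groups $$G\;\cong\;\Big(\prod_X G_a\Big)\times D ,$$ where $G_a(B)=(B,+)$. (2) Let ${\bf A}^*$ be the algebra scheme $B\mapsto \operatorname{Hom}_k(A,B)$ (with the convolution product), let ${\bf I}^*$ be its radical, that is, the kernel of the morphism from ${\bf A}^*$ onto its maximal semisimple quotient, and let ${\bf I}^{*2}$ denote the smallest vector space subscheme of ${\bf A}^*$ containing all products of two points of ${\bf I}^*$. If $G$ is unipotent (every linear representation has an exhaustive increasing filtration, starting at $0$, by subrepresentations on whose successive quotients $G$ acts trivially), then $g-1\in{\bf I}^*(B)$ for every $g\in G(B)$, and $g\mapsto\overline{g-1}$ is an isomorphism of $k$-groups $G\cong {\bf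 I}^*/{\bf I}^{*2}$, the latter with its additive group structure; moreover ${\bf I}^*/{\bf I}^{*2}\cong\prod_X G_a$ for some set $X$. -/

import Mathlib

open CategoryTheory TensorProduct

universe u

noncomputable section

namespace AffineAbelianGroup

/-! ### Functors of groups and affine `k`-groups -/

section Functors

variable (k : Type u) [Field k]

/-- Functors of groups on commutative `k`-algebras. -/
abbrev GroupFunctor : Type (u + 1) := CommAlgCat.{u} k ⥤ GrpCat.{u}

/-- The group `(Spec A)(B) = Hom_{k-alg}(A, B)`, with the (convolution) product
`f * g = m_B ∘ (f ⊗ g) ∘ Δ`, unit `η_B ∘ ε` and inverse `f ∘ S`. -/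
abbrev pointsGroup (A : Type u) [CommRing A] [HopfAlgebra k A]
    (B : Type u) [CommRing B] [Algebra k B] : Group (WithConv (A →ₐ[k] B)) :=
  { (inferInstance : Monoid (WithConv (A →ₐ[k] B))) with
    inv := fun f => WithConv.toConv (f.ofConv.comp (HopfAlgebra.antipodeAlgHom k A))
    inv_mul_cancel := fun f => by
      apply WithConv.ext
      apply AlgHom.ext
      intro a
      change (WithConv.toConv (f.ofConv.comp (HopfAlgebra.antipodeAlgHom k A)) * f) a =
        (1 : WithConv (A →ₐ[k] B)) a
      have h := congrArg f.ofConv (HopfAlgebra.sum_antipode_mul_eq_algebraMap_counit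
        (Coalgebra.Repr.arbitrary k a))
      rw [AlgHom.convMul_apply, AlgHom.convOne_apply,
        ← (Coalgebra.Repr.arbitrary k a).eq]
      simpa using h }

/-- The affine `k`-group `Spec A` of a commutative Hopf algebra `A`, as a functor of groups. -/
def specGroup (A : Type u) [CommRing A] [HopfAlgebra k A] : GroupFunctor k where
  obj B := @GrpCat.of (WithConv (A →ₐ[k] B)) (pointsGroup k A B)
  map {B C} φ :=
    letI := pointsGroup k A B
    letI := pointsGroup k A C
    GrpCat.ofHom (MonoidHom.mk' (fun f => WithConv.toConv (φ.hom.comp f.ofConv))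
      (fun f g => WithConv.ext (AlgHom.comp_convMul_distrib φ.hom f g)))

/-- The additive group `G_a`, with `G_a(B) = (B, +)`. -/
def additiveGroup : GroupFunctor k where
  obj B := GrpCat.of (Multiplicative B)
  map φ := GrpCat.ofHom (AddMonoidHom.toMultiplicative (φ.hom : _ →+ _))

variable {k}

/-- The product of an arbitrary family of functors of groups, computed pointwise. -/
def piGroup {X : Type u} (F : X → GroupFunctor k) : GroupFunctor k where
  obj B := GrpCat.of (∀ x, (F x).obj B)
  map φ := GrpCat.ofHom (MonoidHom.pi fun x => ((F x).map φ).hom.comp (Pi.evalMonoidHom _ x))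

/-- The product of two functors of groups, computed pointwise. -/
def prodGroup (F G : GroupFunctor k) : GroupFunctor k where
  obj B := GrpCat.of (F.obj B × G.obj B)
  map φ := GrpCat.ofHom (MonoidHom.prodMap (F.map φ).hom (G.map φ).hom)

end Functors

/-! ### Linear representations; diagonalizable and unipotent groups -/

section Representations

variable (k : Type u) [Field k] (A : Type u) [CommRing A] [HopfAlgebra k A]

/-- A linear representation of `Spec A` on the vector space `V`: a right `A`-comodule structure
on `V`. -/
structure LinRep (V : Type u) [AddCommGroup V] [Module k V] where
  /-- The coaction. -/
  coact : V →ₗ[k] V ⊗[k] A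
  coassoc : ∀ v, TensorProduct.assoc k V A A (coact.rTensor A (coact v)) =
    (Coalgebra.comul (R := k) (A := A)).lTensor V (coact v)
  counit : ∀ v, TensorProduct.rid k V
    ((Coalgebra.counit (R := k) (A := A)).lTensor V (coact v)) = v

variable {k A}

/-- A subspace `W` is stable under the representation: `ρ(W) ⊆ W ⊗ A`. -/
def LinRep.IsStable {V : Type u} [AddCommGroup V] [Module k V] (ρ : LinRep k A V)
    (W : Submodule k V) : Prop :=
  ∀ v ∈ W, ρ.coact v ∈ LinearMap.range (W.subtype.rTensor A)

variable (k A)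

/-- `Spec A` is diagonalizable: every linear representation is a direct sum of
(simple) subrepresentations of rank `1`. -/
def IsDiagonalizable : Prop :=
  ∀ (V : Type u) [AddCommGroup V] [Module k V] (ρ : LinRep k A V),
    ∃ (ι : Type u) (L : ι → Submodule k V),
      (∀ i, ρ.IsStable (L i) ∧ Module.finrank k (L i) = 1) ∧
      iSupIndep L ∧ ⨆ i, L i = ⊤

/-- `Spec A` is unipotent: every linear representation `V` has an exhaustive filtration
`0 = F₀ ⊆ F₁ ⊆ ⋯` by subrepresentations such that the group acts trivially on each factor
`Fₙ₊₁ / Fₙ`, i.e. `ρ(v) - v ⊗ 1 ∈ Fₙ ⊗ A` for `v ∈ Fₙ₊₁`. -/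
def IsUnipotent : Prop :=
  ∀ (V : Type u) [AddCommGroup V] [Module k V] (ρ : LinRep k A V),
    ∃ F : ℕ → Submodule k V, F 0 = ⊥ ∧ Monotone F ∧ ⨆ n, F n = ⊤ ∧
      (∀ n, ρ.IsStable (F n)) ∧
      ∀ n, ∀ v ∈ F (n + 1), ρ.coact v - v ⊗ₜ[k] (1 : A) ∈
        LinearMap.range ((F n).subtype.rTensor A)

end Representations

/-! ### The algebra scheme `A*`, its radical `I*`, and the vector space scheme `I*/I*²`

`A*` is the functor `B ↦ Hom_k(A, B)`, an algebra under convolution.  The vector space subschemes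
of `A*` are the functors `B ↦ {w ∈ Hom_k(A, B) : w|_W = 0}` for subspaces `W ⊆ A`; the quotient
scheme it defines is `W*`, which is a quotient algebra scheme when `W` is a subcoalgebra. -/

section DualScheme

variable (k : Type u) [Field k] (A : Type u) [CommRing A] [HopfAlgebra k A]

variable {k A} in
/-- The `B`-points of the vector space subscheme of `A*` orthogonal to `W ⊆ A`. -/
def orthogonal (W : Submodule k A) (B : Type u) [CommRing B] [Algebra k B] :
    Submodule B (A →ₗ[k] B) where
  carrier := {w | ∀ a ∈ W, w a = 0}
  add_mem' := fun {w w'} hw hw' a ha => by simp [hw a ha, hw' a ha]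
  zero_mem' := fun a _ => by simp
  smul_mem' := fun b w hw a ha => by simp [hw a ha]

variable {k A} in
/-- `C ⊆ A` is a subcoalgebra: `Δ(C) ⊆ C ⊗ C`. -/
def IsSubcoalgebra (C : Submodule k A) : Prop :=
  ∀ c ∈ C, Coalgebra.comul (R := k) c ∈ LinearMap.range (TensorProduct.map C.subtype C.subtype)

variable {k A} in
/-- `C ⊆ A` is a simple subcoalgebra. -/
def IsSimpleSubcoalgebra (C : Submodule k A) : Prop :=
  IsSubcoalgebra C ∧ C ≠ ⊥ ∧ ∀ C' ≤ C, IsSubcoalgebra C' → C' = ⊥ ∨ C' = C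

/-- The coradical `M` of `A`: the sum of the simple subcoalgebras.  Its dual `M*` is the maximal
semisimple quotient of the algebra scheme `A*`. -/
def coradical : Submodule k A :=
  sSup {C | IsSimpleSubcoalgebra C}

/-- The `B`-points of the radical `I*` of `A*`, i.e. of the kernel of `A* → M*`. -/
def radical (B : Type u) [CommRing B] [Algebra k B] : Submodule B (A →ₗ[k] B) :=
  orthogonal (coradical k A) B

/-- The elements of `A` annihilated by all products `w * w'` of points of `I*`. -/
def radicalSqPerp : Submodule k A where
  carrier := {a | ∀ (B : Type u) [CommRing B] [Algebra k B], ∀ w ∈ radical k A B,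
    ∀ w' ∈ radical k A B, (WithConv.toConv w * WithConv.toConv w').ofConv a = 0}
  add_mem' := fun {a a'} ha ha' B _ _ w hw w' hw' => by
    rw [map_add, ha B w hw w' hw', ha' B w hw w' hw', add_zero]
  zero_mem' := fun B _ _ w _ w' _ => map_zero _
  smul_mem' := fun c a ha B _ _ w hw w' hw' => by
    rw [map_smul, ha B w hw w' hw', smul_zero]

/-- The `B`-points of `I*²`, the closure of the products of points of `I*`, i.e. the
smallest vector space subscheme of `A*` that contains them. -/
def radicalSq (B : Type u) [CommRing B] [Algebra k B] : Submodule B (A →ₗ[k] B) :=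
  orthogonal (radicalSqPerp k A) B

variable {k A} in
/-- `I*²` lies in the vector space subscheme defined by `W` if and only if the latter contains
all products of points of `I*`. -/
theorem radicalSq_le_iff (W : Submodule k A) :
    (∀ (B : Type u) [CommRing B] [Algebra k B], radicalSq k A B ≤ orthogonal W B) ↔
      ∀ (B : Type u) [CommRing B] [Algebra k B], ∀ w ∈ radical k A B, ∀ w' ∈ radical k A B,
        (WithConv.toConv w * WithConv.toConv w').ofConv ∈ orthogonal W B := by
  constructor
  · intro h B _ _ w hw w' hw'
    exact h B fun a ha => ha B w hw w' hw'
  · intro h B _ _ w hw a ha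
    exact hw a fun C _ _ v hv v' hv' => h C v hv v' hv' a ha

/-- The `B`-points of `I*/I*²`, as an additive group. -/
abbrev Cotangent (B : Type u) [CommRing B] [Algebra k B] : Type u :=
  (radical k A B).toAddSubgroup ⧸
    (radicalSq k A B).toAddSubgroup.addSubgroupOf (radical k A B).toAddSubgroup

variable {k A} in
/-- Functoriality of `A*` in `B`, restricted to the subschemes defined by `W`. -/
theorem comp_mem_orthogonal {W : Submodule k A} {B C : Type u} [CommRing B] [Algebra k B]
    [CommRing C] [Algebra k C] (φ : B →ₐ[k] C) {w : A →ₗ[k] B} (hw : w ∈ orthogonal W B) :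
    φ.toLinearMap ∘ₗ w ∈ orthogonal W C := fun a ha => by
  simp [hw a ha]

/-- The map `I*(B) → I*(C)` induced by an algebra map `B → C`. -/
def radicalMap {B C : Type u} [CommRing B] [Algebra k B] [CommRing C] [Algebra k C]
    (φ : B →ₐ[k] C) :
    (radical k A B).toAddSubgroup →+ (radical k A C).toAddSubgroup where
  toFun w := ⟨φ.toLinearMap ∘ₗ w.1, comp_mem_orthogonal φ w.2⟩
  map_zero' := Subtype.ext (LinearMap.comp_zero _)
  map_add' _ _ := Subtype.ext (LinearMap.comp_add _ _ _)

/-- The map `(I*/I*²)(B) → (I*/I*²)(C)` induced by an algebra map `B → C`. -/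
def cotangentMap {B C : Type u} [CommRing B] [Algebra k B] [CommRing C] [Algebra k C]
    (φ : B →ₐ[k] C) : Cotangent k A B →+ Cotangent k A C :=
  QuotientAddGroup.map _ _ (radicalMap k A φ) fun _ hw => comp_mem_orthogonal φ hw

/-- The vector space scheme `I*/I*²`, as a functor of (additive) groups. -/
def cotangentGroup : GroupFunctor k where
  obj B := GrpCat.of (Multiplicative (Cotangent k A B))
  map φ := GrpCat.ofHom (AddMonoidHom.toMultiplicative (cotangentMap k A φ.hom))
  map_id B := by
    apply GrpCat.hom_ext
    apply MonoidHom.ext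
    intro x
    obtain ⟨w, hw⟩ := QuotientAddGroup.mk_surjective (Multiplicative.toAdd x)
    obtain rfl : x = Multiplicative.ofAdd (QuotientAddGroup.mk w) :=
      congrArg Multiplicative.ofAdd hw.symm
    rfl
  map_comp φ ψ := by
    apply GrpCat.hom_ext
    apply MonoidHom.ext
    intro x
    obtain ⟨w, hw⟩ := QuotientAddGroup.mk_surjective (Multiplicative.toAdd x)
    obtain rfl : x = Multiplicative.ofAdd (QuotientAddGroup.mk w) :=
      congrArg Multiplicative.ofAdd hw.symm
    rfl

end DualScheme

end AffineAbelianGroup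

end

/-! The dual `A* = Hom_k(A, k)` is a commutative algebra under convolution, since `A` is
cocommutative, and it acts on `A` by `f • a = (id ⊗ f)(Δ a)`. Every cyclic submodule is
finite-dimensional, so over an algebraically closed field the annihilator of an element contains a
product of kernels of characters. These characters are evaluations at group-like elements. Hence `A`
is the direct sum of generalized weight spaces `A_γ`, with `γ` in the group `Γ` of group-like
elements (`iSupIndep_weightSpace`, `iSup_weightSpace_eq_top`).

On the weight filtration `Δ a` is `a ⊗ γ` up to lower terms, so `a ↦ ε(a) γ` on `A_γ` defines a
bialgebra retraction `r` of `A` onto `k[Γ]` (`exists_groupLikeRetraction`). Let `ι` be the inclusion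
of `k[Γ]`, let `ι'` be its composite with inversion on `Γ`, and put `u = id * (ι' ∘ r)`. This
bialgebra endomorphism sends every group-like element to `1`, and `u * (ι ∘ r) = id`. The difference
of `u` and the convolution unit kills `Γ`, hence is locally nilpotent (`exists_convPow_eq_zero`),
and in characteristic zero `u ^ m (a)` is a polynomial in `m`. Its linear coefficient is `log u`: a
derivation along the counit with values in the space `P` of primitive elements, zero on `Γ` and the
identity on `P`.

Since `g = (g ∘ u) * (g ∘ ι ∘ r)` and `log (g ∘ u) = g ∘ log u`, an algebra map `g` is determined by
its restrictions to `P` and `Γ` (`algHom_ext_of_primitives_of_groupLike`). Conversely, a linear map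
`l` on `P` and a character `χ` of `k[Γ]` come from `exp (l ∘ log u) * (χ ∘ r)`
(`exists_algHom_of_primitives_of_groupLike`). A basis of `P` gives the additive factors, and `Spec
k[Γ]` is the diagonalizable factor.

If the group is unipotent, every nonzero subcoalgebra contains `1`. So `Γ` is trivial, `I*` consists
of the maps vanishing at `1`, and the annihilator of `I*²` is `k ⊕ P`. A class in `I*/I*²` is then a
linear map on `P`, and `g - 1` restricts to `g` there. -/

noncomputable section

set_option linter.unusedSectionVars false

namespace AffineAbelianGroup

open Coalgebra WithConv

/-! ### Functionals on tensor products over a field -/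

section TensorFunctionals

variable {k : Type*} [Field k] {V M : Type*} [AddCommGroup V] [Module k V]
  [AddCommGroup M] [Module k M]

/-- Contraction of the right factor of a tensor product with a functional. -/
def contractRight (V : Type*) [AddCommGroup V] [Module k V] (f : M →ₗ[k] k) :
    V ⊗[k] M →ₗ[k] V :=
  (TensorProduct.rid k V).toLinearMap ∘ₗ f.lTensor V

@[simp]
theorem contractRight_tmul (f : M →ₗ[k] k) (v : V) (m : M) :
    contractRight V f (v ⊗ₜ m) = f m • v := by
  simp [contractRight]

/-- A tensor all of whose contractions on the right lie in `W` lies in `W ⊗ M`. -/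
theorem mem_range_rTensor_of_contractRight_mem (W : Submodule k V) (z : V ⊗[k] M)
    (h : ∀ f : M →ₗ[k] k, contractRight V f z ∈ W) :
    z ∈ LinearMap.range (W.subtype.rTensor M) := by
  classical
  -- The coefficient of `z` at a basis vector of `M` is the contraction of `z` with the dual
  -- coordinate.
  let b := Module.Basis.ofVectorSpace k M
  have hz : z = (TensorProduct.equivFinsuppOfBasisRight b z).sum fun i m => m ⊗ₜ[k] b i := by
    rw [← TensorProduct.equivFinsuppOfBasisRight_symm_apply, LinearEquiv.symm_apply_apply]
  rw [hz]
  refine Submodule.sum_mem _ fun i _ => ?_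
  exact ⟨(⟨_, (TensorProduct.equivFinsuppOfBasisRight_apply b z i).symm ▸ h (b.coord i)⟩ : W) ⊗ₜ b i, rfl⟩

theorem contractRight_mem_of_mem_range_rTensor (W : Submodule k V) {z : V ⊗[k] M}
    (hz : z ∈ LinearMap.range (W.subtype.rTensor M)) (f : M →ₗ[k] k) :
    contractRight V f z ∈ W := by
  obtain ⟨y, rfl⟩ := hz
  induction y using TensorProduct.induction_on with
  | zero => simp
  | tmul v m => simpa using W.smul_mem _ v.2
  | add x y hx hy => simpa using W.add_mem hx hy

theorem eq_zero_of_contractRight_eq_zero (z : V ⊗[k] M)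
    (h : ∀ f : M →ₗ[k] k, contractRight V f z = 0) : z = 0 := by
  obtain ⟨y, rfl⟩ := mem_range_rTensor_of_contractRight_mem (⊥ : Submodule k V) z
    (fun f => by simp [h f])
  have : (⊥ : Submodule k V).subtype = 0 := by
    ext x; exact (Submodule.mem_bot k).1 x.2
  simp [this]

theorem eq_of_forall_functional_eq {x y : V} (h : ∀ f : V →ₗ[k] k, f x = f y) : x = y := by
  rw [← sub_eq_zero, ← Module.forall_dual_apply_eq_zero_iff k]
  intro f
  rw [map_sub, h, sub_self]

end TensorFunctionals

/-! ### The action of the dual algebra on a coalgebra -/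

section DualAction

variable {k : Type*} [Field k] {C : Type*} [AddCommGroup C] [Module k C] [Coalgebra k C]

/-- The pairing formula `h ((id ⊗ f) (Δ a)) = (h * f) a`. -/
theorem apply_contractRight_comul {B : Type*} [Ring B] [Algebra k B]
    (h : C →ₗ[k] B) (f : WithConv (C →ₗ[k] k)) (a : C) :
    h (contractRight C f.ofConv (comul a)) =
      (toConv h * toConv (Algebra.linearMap k B ∘ₗ f.ofConv)) a := by
  rw [LinearMap.convMul_apply]
  induction comul (R := k) a using TensorProduct.induction_on with
  | zero => simp
  | tmul v m => simp [Algebra.smul_def, Algebra.commutes]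
  | add x y hx hy => simp_all

theorem functional_contractRight_comul (h f : WithConv (C →ₗ[k] k)) (a : C) :
    h (contractRight C f.ofConv (comul a)) = (h * f) a :=
  apply_contractRight_comul h.ofConv f a

/-- The dual algebra of a coalgebra acts on it by `f • a = (id ⊗ f) (Δ a)`. -/
instance dualModule : Module (WithConv (C →ₗ[k] k)) C where
  smul f a := contractRight C f.ofConv (comul a)
  one_smul a := by
    change contractRight C (1 : WithConv (C →ₗ[k] k)).ofConv (comul a) = a
    refine eq_of_forall_functional_eq (k := k) fun h => ?_
    rw [functional_contractRight_comul (toConv h), mul_one]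
  mul_smul f g a := by
    change contractRight C (f * g).ofConv (comul a) =
      contractRight C f.ofConv (comul (contractRight C g.ofConv (comul a)))
    refine eq_of_forall_functional_eq (k := k) fun h => ?_
    rw [functional_contractRight_comul (toConv h), functional_contractRight_comul (toConv h),
      functional_contractRight_comul, mul_assoc]
  smul_zero f := by
    change contractRight C f.ofConv (comul (0 : C)) = 0
    simp
  smul_add f a b := by
    change contractRight C f.ofConv (comul (a + b)) = contractRight C f.ofConv (comul a) +
      contractRight C f.ofConv (comul b)
    simp
  add_smul f g a := by
    change contractRight C (f + g).ofConv (comul a) = contractRight C f.ofConv (comul a) +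
      contractRight C g.ofConv (comul a)
    simp [contractRight, LinearMap.lTensor_add]
  zero_smul a := by
    change contractRight C (0 : WithConv (C →ₗ[k] k)).ofConv (comul a) = 0
    simp [contractRight]

theorem dual_smul_def (f : WithConv (C →ₗ[k] k)) (a : C) :
    f • a = contractRight C f.ofConv (comul a) := rfl

theorem functional_dual_smul (h f : WithConv (C →ₗ[k] k)) (a : C) : h (f • a) = (h * f) a :=
  functional_contractRight_comul h f a

theorem counit_dual_smul (f : WithConv (C →ₗ[k] k)) (a : C) :
    counit (R := k) (f • a) = f a := by
  have := functional_dual_smul 1 f a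
  rwa [one_mul, LinearMap.convOne_apply] at this

instance dualModule_isScalarTower : IsScalarTower k (WithConv (C →ₗ[k] k)) C where
  smul_assoc c f a := by
    simp [dual_smul_def, contractRight, LinearMap.lTensor_smul]

theorem dual_smul_of_isGroupLikeElem {γ : C} (hγ : IsGroupLikeElem k γ)
    (f : WithConv (C →ₗ[k] k)) : f • γ = f γ • γ := by
  simp [dual_smul_def, hγ.comul_eq_tmul_self]

/-- Every element generates a finite-dimensional module over the dual algebra. -/
theorem finite_quotient_torsionOf [IsCocomm k C] (a : C) :
    Module.Finite k (WithConv (C →ₗ[k] k) ⧸ Ideal.torsionOf (WithConv (C →ₗ[k] k)) C a) := by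
  let r := Repr.arbitrary k a
  -- The orbit of `a` lies in the span of the left tensor factors of `Δ a`, and the kernel of the
  -- orbit map is the annihilator.
  let W : Submodule k C := Submodule.span k (r.left '' r.index)
  have : FiniteDimensional k W :=
    FiniteDimensional.span_of_finite k (r.index.finite_toSet.image _)
  have hφ : ∀ f : WithConv (C →ₗ[k] k), f • a ∈ W := by
    intro f
    rw [dual_smul_def, ← r.eq, map_sum]
    refine Submodule.sum_mem _ fun i hi => ?_
    rw [contractRight_tmul]
    exact W.smul_mem _ (Submodule.subset_span ⟨i, hi, rfl⟩)
  let ψ : (WithConv (C →ₗ[k] k) ⧸ Ideal.torsionOf (WithConv (C →ₗ[k] k)) C a) →ₗ[k] C :=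
    (LinearMap.restrictScalars k (Submodule.liftQ (Ideal.torsionOf (WithConv (C →ₗ[k] k)) C a)
      (LinearMap.toSpanSingleton (WithConv (C →ₗ[k] k)) C a) fun f hf => hf))
  have hψ : ∀ x, ψ x ∈ W := by
    intro x
    obtain ⟨f, rfl⟩ := Ideal.Quotient.mk_surjective x
    exact hφ f
  refine FiniteDimensional.of_injective (ψ.codRestrict W hψ) ?_
  rw [← LinearMap.ker_eq_bot, LinearMap.ker_eq_bot']
  intro x hx
  obtain ⟨f, rfl⟩ := Ideal.Quotient.mk_surjective x
  rw [Ideal.Quotient.eq_zero_iff_mem]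
  exact congrArg Subtype.val hx

/-- A character of the dual algebra that annihilates the annihilator of an element is the
evaluation at a group-like element. -/
theorem exists_isGroupLikeElem_of_character [IsCocomm k C] (χ : WithConv (C →ₗ[k] k) →ₐ[k] k)
    (a : C) (hχ : ∀ f : WithConv (C →ₗ[k] k), f • a = 0 → χ f = 0) :
    ∃ γ : C, IsGroupLikeElem k γ ∧ ∀ f : WithConv (C →ₗ[k] k), χ f = f γ := by
  let r := Repr.arbitrary k a
  let ev : C → (WithConv (C →ₗ[k] k)) →ₗ[k] k := fun c =>
    (LinearMap.applyₗ c) ∘ₗ (WithConv.linearEquiv k (C →ₗ[k] k)).toLinearMap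
  -- If `f` kills every right tensor factor of `Δ a`, then `f • a = 0` and so `χ f = 0`. Thus `χ` is
  -- a combination of the finitely many evaluations at these factors, hence itself an evaluation.
  have hspan : χ.toLinearMap ∈ Submodule.span k (Set.range fun i : r.index => ev (r.right i)) := by
    refine mem_span_of_iInf_ker_le_ker fun f hf => ?_
    rw [LinearMap.mem_ker]
    refine hχ f ?_
    rw [dual_smul_def, ← r.eq, map_sum]
    refine Finset.sum_eq_zero fun i hi => ?_
    rw [contractRight_tmul]
    have := (Submodule.mem_iInf _).1 hf ⟨i, hi⟩
    rw [LinearMap.mem_ker] at this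
    have h2 : f (r.right i) = 0 := this
    rw [h2, zero_smul]
  obtain ⟨c, hc⟩ := (Submodule.mem_span_range_iff_exists_fun k).1 hspan
  let γ : C := ∑ i, c i • r.right i
  have hev : ∀ f : WithConv (C →ₗ[k] k), χ f = f γ := by
    intro f
    have := LinearMap.congr_fun hc f
    simp only [LinearMap.sum_apply, LinearMap.smul_apply] at this
    refine this.symm.trans ?_
    simp [γ, ev]
  refine ⟨γ, ⟨?_, ?_⟩, hev⟩
  · have := hev 1
    rw [map_one, LinearMap.convOne_apply] at this
    exact this.symm
  -- Tested against pairs of functionals, `Δ γ = γ ⊗ γ` is the multiplicativity of `χ`.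
  · rw [← sub_eq_zero]
    refine eq_zero_of_contractRight_eq_zero _ fun f => eq_of_forall_functional_eq (k := k) fun h => ?_
    rw [map_sub, map_sub, functional_contractRight_comul (toConv h) (toConv f), ← hev, map_mul,
      hev, hev]
    simp [mul_comm]

end DualAction

/-! ### Weight filtrations -/

section Weights

variable {k : Type*} [Field k] {C : Type*} [AddCommGroup C] [Module k C] [Coalgebra k C]

/-- Evaluation at a group-like element as a character of the dual algebra. -/
def evalGroupLike (γ : GroupLike k C) : WithConv (C →ₗ[k] k) →ₐ[k] k :=
  AlgHom.ofLinearMap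
    ((LinearMap.applyₗ γ.val) ∘ₗ (WithConv.linearEquiv k (C →ₗ[k] k)).toLinearMap)
    (by
      change (1 : WithConv (C →ₗ[k] k)) γ.val = 1
      simp [γ.2.counit_eq_one])
    (fun f g => by
      change (f * g) γ.val = f γ.val * g γ.val
      simp [γ.2.comul_eq_tmul_self])

@[simp]
theorem evalGroupLike_apply (γ : GroupLike k C) (f : WithConv (C →ₗ[k] k)) :
    evalGroupLike γ f = f γ.val := rfl

variable [IsCocomm k C]

/-- The maximal ideal of the dual algebra attached to a group-like element. -/
def weightIdeal (γ : GroupLike k C) : Ideal (WithConv (C →ₗ[k] k)) :=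
  RingHom.ker (evalGroupLike γ)

theorem mem_weightIdeal {γ : GroupLike k C} {f : WithConv (C →ₗ[k] k)} :
    f ∈ weightIdeal γ ↔ f γ.val = 0 := Iff.rfl

theorem weightIdeal_isMaximal (γ : GroupLike k C) : (weightIdeal γ).IsMaximal :=
  RingHom.ker_isMaximal_of_surjective (evalGroupLike γ) fun c =>
    ⟨algebraMap k _ c, AlgHom.commutes _ c⟩

theorem sub_algebraMap_mem_weightIdeal (γ : GroupLike k C) (f : WithConv (C →ₗ[k] k)) :
    f - algebraMap k _ (f γ.val) ∈ weightIdeal γ := by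
  change evalGroupLike γ _ = 0
  rw [map_sub, AlgHom.commutes]
  simp

theorem weightIdeal_injective :
    Function.Injective (weightIdeal : GroupLike k C → Ideal (WithConv (C →ₗ[k] k))) := by
  intro γ δ h
  apply GroupLike.val_injective
  refine eq_of_forall_functional_eq (k := k) fun f => ?_
  have := sub_algebraMap_mem_weightIdeal γ (toConv f)
  rw [h] at this
  change evalGroupLike δ _ = 0 at this
  rw [map_sub, AlgHom.commutes, sub_eq_zero] at this
  exact this.symm

theorem weightIdeal_pow_sup_eq_top {γ δ : GroupLike k C} (h : γ ≠ δ) (m n : ℕ) :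
    weightIdeal γ ^ m ⊔ weightIdeal δ ^ n = ⊤ := by
  have := weightIdeal_isMaximal γ
  have := weightIdeal_isMaximal δ
  exact Ideal.pow_sup_pow_eq_top
    (Ideal.isCoprime_of_isMaximal (weightIdeal_injective.ne h)).sup_eq

/-- The `n`-th step of the filtration of the generalized weight space of weight `γ`. -/
def weightFiltration (γ : GroupLike k C) (n : ℕ) : Submodule (WithConv (C →ₗ[k] k)) C :=
  Submodule.torsionBySet _ C (weightIdeal γ ^ n : Ideal (WithConv (C →ₗ[k] k)))

theorem mem_weightFiltration {γ : GroupLike k C} {n : ℕ} {a : C} :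
    a ∈ weightFiltration γ n ↔ ∀ f ∈ weightIdeal γ ^ n, f • a = 0 := by
  simp [weightFiltration, Submodule.mem_torsionBySet_iff]

theorem weightFiltration_zero (γ : GroupLike k C) : weightFiltration γ 0 = ⊥ := by
  rw [eq_bot_iff]
  intro a ha
  rw [Submodule.mem_bot, ← one_smul (WithConv (C →ₗ[k] k)) a]
  exact mem_weightFiltration.1 ha 1 (by simp)

theorem weightFiltration_mono (γ : GroupLike k C) : Monotone (weightFiltration γ) :=
  fun i j h => Submodule.torsionBySet_le_torsionBySet_pow i j h _

/-- The recursive form of the filtration, which drives the inductions on its level. -/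
theorem mem_weightFiltration_succ {γ : GroupLike k C} {n : ℕ} {a : C} :
    a ∈ weightFiltration γ (n + 1) ↔ ∀ f ∈ weightIdeal γ, f • a ∈ weightFiltration γ n := by
  simp only [mem_weightFiltration, Submodule.pow_succ]
  constructor
  · intro h f hf g hg
    rw [← mul_smul]
    exact h _ (Ideal.mul_mem_mul hg hf)
  · intro h f hf
    induction hf using Submodule.mul_induction_on' with
    | mem_mul_mem g hg f hf =>
      rw [mul_smul]
      exact h f hf g hg
    | add x _ y _ hx hy => rw [add_smul, hx, hy, add_zero]

theorem val_mem_weightFiltration_one (γ : GroupLike k C) : γ.val ∈ weightFiltration γ 1 := by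
  rw [← zero_add 1, mem_weightFiltration_succ]
  intro f hf
  rw [dual_smul_of_isGroupLikeElem γ.2, mem_weightIdeal.1 hf, zero_smul]
  exact zero_mem _

/-- On the weight filtration the comultiplication is `a ↦ a ⊗ γ` up to lower order terms. -/
theorem comul_sub_tmul_mem {γ : GroupLike k C} {n : ℕ} {a : C}
    (ha : a ∈ weightFiltration γ (n + 1)) :
    comul (R := k) a - a ⊗ₜ[k] γ.val ∈
      LinearMap.range (((weightFiltration γ n).restrictScalars k).subtype.rTensor C) := by
  refine mem_range_rTensor_of_contractRight_mem _ _ fun f => ?_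
  have := mem_weightFiltration_succ.1 ha _ (sub_algebraMap_mem_weightIdeal γ (toConv f))
  rw [sub_smul, algebraMap_smul] at this
  rw [map_sub, contractRight_tmul]
  exact this

/-- Each step is a submodule for the dual action, and such submodules are subcomodules. -/
theorem comul_mem_weightFiltration {γ : GroupLike k C} {n : ℕ} {a : C}
    (ha : a ∈ weightFiltration γ n) :
    comul (R := k) a ∈
      LinearMap.range (((weightFiltration γ n).restrictScalars k).subtype.rTensor C) :=
  mem_range_rTensor_of_contractRight_mem _ _ fun f =>
    (weightFiltration γ n).smul_mem (toConv f) ha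

/-- A power of a linear map that kills all group-like elements kills the corresponding step of
the weight filtrations. -/
theorem convPow_eq_zero_of_mem_weightFiltration {B : Type*} [Ring B] [Algebra k B]
    (f : WithConv (C →ₗ[k] B)) (hf : ∀ γ : GroupLike k C, f γ.val = 0) (γ : GroupLike k C)
    {n m : ℕ} (hm : n ≤ m) {a : C} (ha : a ∈ weightFiltration γ n) : (f ^ m) a = 0 := by
  suffices H : ∀ n, ∀ a ∈ weightFiltration γ n, (f ^ n) a = 0 from
    H m a (weightFiltration_mono γ hm ha)
  intro n
  induction n with
  | zero =>
    intro a ha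
    rw [weightFiltration_zero] at ha
    rw [(Submodule.mem_bot _).1 ha, map_zero]
  | succ n ih =>
    intro a ha
    obtain ⟨y, hy⟩ := comul_sub_tmul_mem ha
    -- The leading term `a ⊗ γ` is killed by the last factor `f`; the rest lies in the previous step
    -- tensored with `C`, where `f ^ n` vanishes.
    rw [pow_succ, LinearMap.convMul_apply, ← sub_add_cancel (comul (R := k) a) (a ⊗ₜ[k] γ.val),
      ← hy, map_add, map_add, TensorProduct.map_tmul, LinearMap.mul'_apply, hf γ, mul_zero,
      add_zero]
    clear hy
    induction y using TensorProduct.induction_on with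
    | zero => simp
    | tmul v m => simp [ih v.1 v.2]
    | add x y hx hy => rw [map_add, map_add, map_add, hx, hy, add_zero]

end Weights

/-! ### The weight decomposition -/

/-- An ideal of finite codimension in a commutative algebra over an algebraically closed field
contains a product of kernels of characters that vanish on it. -/
theorem exists_prod_ker_character_le {k D : Type*} [Field k] [IsAlgClosed k] [CommRing D]
    [Algebra k D] (I : Ideal D) [Module.Finite k (D ⧸ I)] :
    ∃ Z : Multiset {χ : D →ₐ[k] k // I ≤ RingHom.ker χ},
      (Z.map fun χ => RingHom.ker χ.1).prod ≤ I := by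
  have : IsNoetherianRing (D ⧸ I) := isNoetherian_of_tower k inferInstance
  have key : ∀ p : PrimeSpectrum (D ⧸ I), ∃ χ : {χ : D →ₐ[k] k // I ≤ RingHom.ker χ},
      RingHom.ker χ.1 = p.asIdeal.comap (Ideal.Quotient.mk I) := by
    intro p
    -- The quotient by a prime is a finite-dimensional domain over an algebraically closed field,
    -- hence `k` itself.
    let e : k ≃ₐ[k] ((D ⧸ I) ⧸ p.asIdeal) := AlgEquiv.ofBijective (Algebra.ofId _ _)
      IsAlgClosed.algebraMap_bijective_of_isIntegral
    let χ : D →ₐ[k] k :=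
      e.symm.toAlgHom.comp ((Ideal.Quotient.mkₐ k p.asIdeal).comp (Ideal.Quotient.mkₐ k I))
    have hχ : ∀ f, χ f = 0 ↔ Ideal.Quotient.mk I f ∈ p.asIdeal := by
      intro f
      rw [← Ideal.Quotient.eq_zero_iff_mem]
      exact map_eq_zero_iff e.symm e.symm.injective
    refine ⟨⟨χ, fun f hf => ?_⟩, ?_⟩
    · rw [RingHom.mem_ker, hχ, Ideal.Quotient.eq_zero_iff_mem.2 hf]
      exact zero_mem _
    · ext f
      rw [RingHom.mem_ker, hχ, Ideal.mem_comap]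
  choose χ hχ using key
  -- In a Noetherian ring the zero ideal contains a finite product of primes.
  obtain ⟨Z, hZ⟩ := PrimeSpectrum.exists_primeSpectrum_prod_le (D ⧸ I) ⊥
  refine ⟨Z.map χ, fun f hf => ?_⟩
  rw [← Ideal.Quotient.eq_zero_iff_mem (I := I)]
  have h1 : Ideal.map (Ideal.Quotient.mk I)
      ((Z.map χ).map fun χ => RingHom.ker χ.1).prod ≤ ⊥ := by
    refine le_trans ?_ hZ
    rw [← Ideal.mapHom_apply, map_multiset_prod, Multiset.map_map, Multiset.map_map]
    apply le_of_eq
    congr 1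
    refine Multiset.map_congr rfl fun p _ => ?_
    simp only [Function.comp_apply, Ideal.mapHom_apply, hχ]
    exact Ideal.map_comap_of_surjective _ Ideal.Quotient.mk_surjective _
  exact (Submodule.mem_bot _).1 (h1 (Ideal.mem_map_of_mem _ hf))

section WeightDecomposition

variable {k : Type*} [Field k] {C : Type*} [AddCommGroup C] [Module k C] [Coalgebra k C]
  [IsCocomm k C]

/-- The generalized weight space of weight `γ`. -/
def weightSpace (γ : GroupLike k C) : Submodule (WithConv (C →ₗ[k] k)) C :=
  ⨆ n, weightFiltration γ n

theorem mem_weightSpace {γ : GroupLike k C} {a : C} :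
    a ∈ weightSpace γ ↔ ∃ n, a ∈ weightFiltration γ n :=
  Submodule.mem_iSup_of_directed _ (weightFiltration_mono γ).directed_le

theorem val_mem_weightSpace (γ : GroupLike k C) : γ.val ∈ weightSpace γ :=
  mem_weightSpace.2 ⟨1, val_mem_weightFiltration_one γ⟩

theorem iSupIndep_weightFiltration (n : ℕ) :
    iSupIndep fun γ : GroupLike k C => weightFiltration γ n :=
  iSupIndep_iff_supIndep.2 fun s => Submodule.supIndep_torsionBySet_ideal (S := s)
    fun _ _ _ _ h => weightIdeal_pow_sup_eq_top h n n

/-- A finite relation lives at one common filtration level, where torsion submodules of pairwise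
comaximal ideals are independent. -/
theorem iSupIndep_weightSpace :
    iSupIndep (weightSpace : GroupLike k C → Submodule (WithConv (C →ₗ[k] k)) C) := by
  classical
  rw [iSupIndep_iff_finsetSum_eq_zero_imp_eq_zero]
  intro s v hv hs
  choose n hn using fun i : s => mem_weightSpace.1 (hv i.1 i.2)
  exact (iSupIndep_iff_finsetSum_eq_zero_imp_eq_zero _).1
    (iSupIndep_weightFiltration (s.attach.sup n)) s v (fun i hi => weightFiltration_mono i
      (Finset.le_sup (f := n) (Finset.mem_attach s ⟨i, hi⟩)) (hn ⟨i, hi⟩)) hs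

theorem exists_prod_weightIdeal_le [IsAlgClosed k] (a : C) :
    ∃ Z : Multiset (GroupLike k C),
      (Z.map weightIdeal).prod ≤ Ideal.torsionOf (WithConv (C →ₗ[k] k)) C a := by
  have := finite_quotient_torsionOf (k := k) a
  obtain ⟨Z, hZ⟩ := exists_prod_ker_character_le (k := k)
    (Ideal.torsionOf (WithConv (C →ₗ[k] k)) C a)
  have key : ∀ χ : {χ : WithConv (C →ₗ[k] k) →ₐ[k] k //
      Ideal.torsionOf (WithConv (C →ₗ[k] k)) C a ≤ RingHom.ker χ},
      ∃ γ : GroupLike k C, weightIdeal γ = RingHom.ker χ.1 := by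
    intro χ
    obtain ⟨γ, hγ, h⟩ := exists_isGroupLikeElem_of_character χ.1 a fun f hf => χ.2 hf
    refine ⟨⟨γ, hγ⟩, ?_⟩
    ext f
    rw [mem_weightIdeal, ← h, RingHom.mem_ker]
  choose γ hγ using key
  refine ⟨Z.map γ, le_trans (le_of_eq ?_) hZ⟩
  rw [Multiset.map_map]
  congr 1
  exact Multiset.map_congr rfl fun χ _ => hγ χ

/-- Chinese remainder argument: `a` is killed by a product of powers of pairwise comaximal ideals.
That product is their intersection, whose torsion is the sum of the separate torsions. -/
theorem iSup_weightSpace_eq_top [IsAlgClosed k] :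
    ⨆ γ : GroupLike k C, weightSpace γ = ⊤ := by
  classical
  rw [eq_top_iff]
  intro a _
  obtain ⟨Z, hZ⟩ := exists_prod_weightIdeal_le (k := k) a
  rw [Finset.prod_multiset_map_count, Ideal.prod_eq_iInf_of_pairwise_isCoprime] at hZ
  · have hmem : a ∈ Submodule.torsionBySet (WithConv (C →ₗ[k] k)) C
        (⨅ γ ∈ Z.toFinset, weightIdeal γ ^ Z.count γ : Ideal (WithConv (C →ₗ[k] k))) := by
      rw [Submodule.mem_torsionBySet_iff]
      exact fun f => hZ f.2
    rw [← Submodule.iSup_torsionBySet_ideal_eq_torsionBySet_iInf] at hmem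
    · have hle : ⨆ γ ∈ Z.toFinset, weightFiltration γ (Z.count γ) ≤
          ⨆ γ : GroupLike k C, weightSpace γ :=
        iSup_le fun γ => iSup_le fun _ =>
          (le_iSup (weightFiltration γ) (Z.count γ)).trans (le_iSup weightSpace γ)
      exact hle hmem
    · exact fun γ _ δ _ h => weightIdeal_pow_sup_eq_top h _ _
  · exact fun γ _ δ _ h => Ideal.isCoprime_iff_sup_eq.2 (weightIdeal_pow_sup_eq_top h _ _)

/-- An element of a direct sum of weight spaces is killed by a high power of a linear map that
vanishes on the group-like elements. -/
theorem exists_convPow_eq_zero [IsAlgClosed k] {B : Type*} [Ring B] [Algebra k B]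
    (f : WithConv (C →ₗ[k] B)) (hf : ∀ γ : GroupLike k C, f γ.val = 0) (a : C) :
    ∃ n, ∀ m, n ≤ m → (f ^ m) a = 0 := by
  have ha : a ∈ ⨆ γ : GroupLike k C, weightSpace γ := by simp [iSup_weightSpace_eq_top]
  induction ha using Submodule.iSup_induction' with
  | mem γ x hx =>
    obtain ⟨n, hn⟩ := mem_weightSpace.1 hx
    exact ⟨n, fun m hm => convPow_eq_zero_of_mem_weightFiltration f hf γ hm hn⟩
  | zero => exact ⟨0, fun m _ => map_zero _⟩
  | add x y _ _ hx hy =>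
    obtain ⟨n, hn⟩ := hx
    obtain ⟨m, hm⟩ := hy
    exact ⟨max n m, fun l hl => by
      rw [map_add, hn l (le_of_max_le_left hl), hm l (le_of_max_le_right hl), add_zero]⟩

end WeightDecomposition

/-! ### The retraction onto the group algebra of the group-like elements -/

section Retraction

variable {k : Type*} [Field k] {A : Type*} [CommRing A] [HopfAlgebra k A] [IsCocomm k A]

/-- By multiplicativity of `Δ`, applying a functional that vanishes at `γδ` to `ab` leaves only
products in which one factor has dropped a level. The bound `n + m` is not sharp, but it avoids
subtraction. -/
theorem mul_mem_weightFiltration {γ δ : GroupLike k A} {n m : ℕ} {a b : A}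
    (ha : a ∈ weightFiltration γ n) (hb : b ∈ weightFiltration δ m) :
    a * b ∈ weightFiltration (γ * δ) (n + m) := by
  induction hN : n + m generalizing n m a b with
  | zero =>
    obtain rfl : n = 0 := by omega
    rw [weightFiltration_zero] at ha
    rw [(Submodule.mem_bot _).1 ha, zero_mul]
    exact zero_mem _
  | succ N ih =>
    rcases n with _ | n
    · rw [weightFiltration_zero] at ha
      rw [(Submodule.mem_bot _).1 ha, zero_mul]
      exact zero_mem _
    rcases m with _ | m
    · rw [weightFiltration_zero] at hb
      rw [(Submodule.mem_bot _).1 hb, mul_zero]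
      exact zero_mem _
    rw [mem_weightFiltration_succ]
    intro f hf
    obtain ⟨x, hx⟩ := comul_sub_tmul_mem ha
    obtain ⟨y, hy⟩ := comul_sub_tmul_mem hb
    obtain ⟨z, hz⟩ := comul_mem_weightFiltration hb
    have hfg : f (γ.val * δ.val) = 0 := mem_weightIdeal.1 hf
    have hsplit : comul (R := k) (a * b) = (a * b) ⊗ₜ[k] (γ.val * δ.val) +
        (((comul (R := k) a - a ⊗ₜ[k] γ.val) * comul b) +
          (a ⊗ₜ[k] γ.val) * (comul b - b ⊗ₜ[k] δ.val)) := by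
      rw [Bialgebra.comul_mul, ← Algebra.TensorProduct.tmul_mul_tmul]
      ring
    rw [dual_smul_def, hsplit, map_add, contractRight_tmul, hfg, zero_smul, zero_add, map_add,
      ← hx, ← hy, ← hz]
    clear hx hy hz hsplit
    refine add_mem ?_ ?_
    · induction x using TensorProduct.induction_on with
      | zero => simp
      | add x x' hx hx' => rw [map_add, add_mul, map_add]; exact add_mem hx hx'
      | tmul x x' =>
        induction z using TensorProduct.induction_on with
        | zero => simp
        | add z z' hz hz' => rw [map_add, mul_add, map_add]; exact add_mem hz hz'
        | tmul z z' =>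
          rw [LinearMap.rTensor_tmul, LinearMap.rTensor_tmul, Algebra.TensorProduct.tmul_mul_tmul,
            contractRight_tmul]
          exact ((weightFiltration (γ * δ) N).restrictScalars k).smul_mem _
            (ih x.2 z.2 (by omega))
    · induction y using TensorProduct.induction_on with
      | zero => simp
      | add y y' hy hy' => rw [map_add, mul_add, map_add]; exact add_mem hy hy'
      | tmul y y' =>
        rw [LinearMap.rTensor_tmul, Algebra.TensorProduct.tmul_mul_tmul, contractRight_tmul]
        exact ((weightFiltration (γ * δ) N).restrictScalars k).smul_mem _
          (ih ha y.2 (by omega))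

theorem mul_mem_weightSpace {γ δ : GroupLike k A} {a b : A}
    (ha : a ∈ weightSpace γ) (hb : b ∈ weightSpace δ) : a * b ∈ weightSpace (γ * δ) := by
  obtain ⟨n, hn⟩ := mem_weightSpace.1 ha
  obtain ⟨m, hm⟩ := mem_weightSpace.1 hb
  exact mem_weightSpace.2 ⟨n + m, mul_mem_weightFiltration hn hm⟩

variable [IsAlgClosed k]

variable (k A) in
-- The weight spaces form a direct sum, so a linear map may be prescribed on each of them.
theorem exists_linear_groupLikeRetraction :
    ∃ r : A →ₗ[k] MonoidAlgebra k (GroupLike k A), ∀ γ : GroupLike k A, ∀ a ∈ weightSpace γ,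
      r a = MonoidAlgebra.single γ (counit (R := k) a) := by
  classical
  have hint : DirectSum.IsInternal
      (weightSpace : GroupLike k A → Submodule (WithConv (A →ₗ[k] k)) A) :=
    DirectSum.isInternal_submodule_of_iSupIndep_of_iSup_eq_top iSupIndep_weightSpace
      iSup_weightSpace_eq_top
  let e := LinearEquiv.ofBijective (DirectSum.coeLinearMap weightSpace) hint
  let s : DirectSum (GroupLike k A) (fun γ => (weightSpace γ).restrictScalars k) →ₗ[k]
      MonoidAlgebra k (GroupLike k A) :=
    DirectSum.toModule k (GroupLike k A) (MonoidAlgebra k (GroupLike k A))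
      fun γ => MonoidAlgebra.lsingle γ ∘ₗ counit ∘ₗ ((weightSpace γ).restrictScalars k).subtype
  refine ⟨s ∘ₗ e.symm.toLinearMap.restrictScalars k, fun γ a ha => ?_⟩
  have he : e.symm a = DirectSum.lof (WithConv (A →ₗ[k] k)) (GroupLike k A)
      (fun γ => weightSpace γ) γ ⟨a, ha⟩ := by
    rw [LinearEquiv.symm_apply_eq]
    exact (DirectSum.coeLinearMap_lof weightSpace γ ⟨a, ha⟩).symm
  change s (e.symm a) = _
  rw [he]
  exact DirectSum.toModule_lof k (M := fun γ : GroupLike k A => (weightSpace γ).restrictScalars k)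
    γ ⟨a, ha⟩

@[elab_as_elim]
theorem weightSpace_induction {p : A → Prop} (a : A)
    (mem : ∀ γ : GroupLike k A, ∀ x ∈ weightSpace γ, p x)
    (add : ∀ x y, p x → p y → p (x + y)) : p a := by
  have ha : a ∈ ⨆ γ : GroupLike k A, weightSpace γ := by simp [iSup_weightSpace_eq_top]
  induction ha using Submodule.iSup_induction' with
  | mem γ x hx => exact mem γ x hx
  | zero => exact mem 1 0 (zero_mem _)
  | add x y _ _ hx hy => exact add x y hx hy

variable (k A) in
/-- The retraction onto the group algebra of the group-like elements is a bialgebra map. -/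
theorem exists_groupLikeRetraction :
    ∃ r : A →ₐc[k] MonoidAlgebra k (GroupLike k A), ∀ γ : GroupLike k A, ∀ a ∈ weightSpace γ,
      r a = MonoidAlgebra.single γ (counit (R := k) a) := by
  obtain ⟨r, hr⟩ := exists_linear_groupLikeRetraction k A
  have hone : r 1 = 1 := by
    rw [hr 1 1 (val_mem_weightSpace 1), Bialgebra.counit_one, MonoidAlgebra.one_def]
  have hmul : ∀ a b, r (a * b) = r a * r b := by
    intro a b
    refine weightSpace_induction (k := k) a (fun γ x hx => ?_) fun x y hx hy => ?_
    · refine weightSpace_induction (k := k) b (fun δ y hy => ?_) fun y z hy hz => ?_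
      · rw [hr _ _ hx, hr _ _ hy, hr _ _ (mul_mem_weightSpace hx hy), Bialgebra.counit_mul,
          MonoidAlgebra.single_mul_single]
      · rw [mul_add, map_add, hy, hz, map_add, mul_add]
    · rw [add_mul, map_add, hx, hy, map_add, add_mul]
  refine ⟨BialgHom.ofAlgHom (AlgHom.ofLinearMap r hone hmul) ?_ ?_, hr⟩
  · ext a
    change counit (R := k) (r a) = counit a
    refine weightSpace_induction (k := k) a (fun γ x hx => ?_) fun x y hx hy => ?_
    · rw [hr _ _ hx, MonoidAlgebra.counit_single]; rfl
    · rw [map_add, map_add, hx, hy, map_add]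
  · ext a
    change TensorProduct.map r r (comul a) = comul (r a)
    refine weightSpace_induction (k := k) a (fun γ x hx => ?_) fun x y hx hy => ?_
    -- The left factors of `Δ x` stay in the filtration of weight `γ`, where `r` is the counit times
    -- `γ`; the counit axiom then gives `(r ⊗ id)(Δ x) = γ ⊗ x`.
    · have hleft : r.rTensor A (comul x) = MonoidAlgebra.single γ 1 ⊗ₜ[k] x := by
        obtain ⟨n, hn⟩ := mem_weightSpace.1 hx
        obtain ⟨z, hz⟩ := comul_mem_weightFiltration hn
        have hcounit := rTensor_counit_comul (R := k) x
        rw [← hz] at hcounit ⊢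
        have hcomp : ∀ z, r.rTensor A ((((weightFiltration γ n).restrictScalars k).subtype.rTensor
            A) z) = (MonoidAlgebra.lsingle γ).rTensor A ((counit (R := k)).rTensor A
              ((((weightFiltration γ n).restrictScalars k).subtype.rTensor A) z)) := by
          intro z
          induction z using TensorProduct.induction_on with
          | zero => simp
          | add x y hx hy => rw [map_add, map_add, hx, hy, map_add, map_add]
          | tmul y y' =>
            simp only [LinearMap.rTensor_tmul, Submodule.subtype_apply]
            rw [hr γ y (mem_weightSpace.2 ⟨n, y.2⟩)]
            rfl
        rw [hcomp, hcounit]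
        simp
      rw [show TensorProduct.map r r (comul x) = r.lTensor _ (r.rTensor A (comul x)) by
        rw [← LinearMap.lTensor_comp_rTensor]; rfl, hleft,
        LinearMap.lTensor_tmul, hr _ _ hx, MonoidAlgebra.comul_single]
      simp
    · rw [map_add, map_add, hx, hy, map_add, map_add]

end Retraction

/-! ### Polynomials determined by their values at the natural numbers -/

section PolynomialValues

open Polynomial

theorem isUnit_natCast_succ (k : Type*) [Field k] [CharZero k] {B : Type*} [CommRing B]
    [Algebra k B] (n : ℕ) : IsUnit ((n : B) + 1) := by
  have h : IsUnit (algebraMap k B ((n : k) + 1)) :=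
    (IsUnit.mk0 _ (Nat.cast_add_one_ne_zero n)).map _
  simpa using h

/-- Zero divisors in `B` rule out counting roots. Differences of distinct natural numbers are units,
however, so after division by a linear factor the quotient still vanishes at the remaining points.
-/
theorem polynomial_eq_zero_of_eval_natCast_eq_zero (k : Type*) [Field k] [CharZero k]
    {B : Type*} [CommRing B] [Algebra k B] (p : B[X])
    (hp : ∀ m : ℕ, p.eval (m : B) = 0) : p = 0 := by
  nontriviality B
  -- The offset `c` lets the induction continue with the roots `c + 1, c + 2, …` once `X - c` has
  -- been divided out.
  suffices H : ∀ (d : ℕ) (c : ℕ) (p : B[X]), p.natDegree < d →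
      (∀ m : ℕ, p.eval ((c + m : ℕ) : B) = 0) → p = 0 from
    H (p.natDegree + 1) 0 p (Nat.lt_succ_self _) (by simpa using hp)
  intro d
  induction d with
  | zero => intro c p h; omega
  | succ d ih =>
    intro c p hd h
    obtain ⟨q, rfl⟩ : X - C (c : B) ∣ p := dvd_iff_isRoot.2 (by simpa using h 0)
    by_cases hq : q = 0
    · rw [hq, mul_zero]
    · refine absurd (ih (c + 1) q ?_ fun m => ?_) hq
      · rw [(monic_X_sub_C (c : B)).natDegree_mul' hq, natDegree_X_sub_C] at hd
        omega
      · have := h (m + 1)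
        rw [eval_mul, eval_sub, eval_X, eval_C] at this
        have hu := isUnit_natCast_succ k (B := B) m
        rw [show ((c + (m + 1) : ℕ) : B) - c = (m : B) + 1 by push_cast; ring,
          hu.mul_right_eq_zero] at this
        rw [← this]
        congr 1
        push_cast
        ring

theorem polynomial_eq_of_eval_natCast_eq (k : Type*) [Field k] [CharZero k]
    {B : Type*} [CommRing B] [Algebra k B] {p q : B[X]}
    (h : ∀ m : ℕ, p.eval (m : B) = q.eval (m : B)) : p = q := by
  rw [← sub_eq_zero]
  exact polynomial_eq_zero_of_eval_natCast_eq_zero k _ fun m => by rw [eval_sub, h, sub_self]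

/-- The binomial coefficient `X choose n` as a polynomial. -/
def choosePoly (k : Type*) [Field k] (B : Type*) [CommRing B] [Algebra k B] (n : ℕ) : B[X] :=
  C (algebraMap k B (n.factorial : k)⁻¹) * descPochhammer B n

theorem eval_choosePoly (k : Type*) [Field k] [CharZero k] {B : Type*} [CommRing B]
    [Algebra k B] (n m : ℕ) :
    (choosePoly k B n).eval (m : B) = (m.choose n : B) := by
  rw [choosePoly, eval_mul, eval_C, descPochhammer_eval_eq_descFactorial,
    Nat.descFactorial_eq_factorial_mul_choose, Nat.cast_mul, ← mul_assoc,
    ← map_natCast (algebraMap k B) n.factorial, ← map_mul,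
    inv_mul_cancel₀ (Nat.cast_ne_zero.2 n.factorial_ne_zero), map_one, one_mul]

end PolynomialValues

/-! ### Logarithms in convolution algebras -/

section Logarithm

open Polynomial

variable {k : Type*} [Field k] {C : Type*} [AddCommGroup C] [Module k C]
  [Coalgebra k C] {B : Type*} [CommRing B] [Algebra k B]

/-- The convolution powers of `u` depend polynomially on the exponent. -/
def HasPolynomialPowers (u : WithConv (C →ₗ[k] B)) : Prop :=
  ∀ a, ∃ p : B[X], ∀ m : ℕ, p.eval (m : B) = (u ^ m) a

/-- Pointwise nilpotency for convolution powers. -/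
def IsLocallyNilpotent (x : WithConv (C →ₗ[k] B)) : Prop :=
  ∀ a, ∃ n, ∀ m, n ≤ m → (x ^ m) a = 0

variable [CharZero k]

theorem conv_sum_apply {ι : Type*} (s : Finset ι) (f : ι → WithConv (C →ₗ[k] B)) (a : C) :
    (∑ i ∈ s, f i) a = ∑ i ∈ s, f i a := by
  simp

/-- Expand `(1 + (u - 1)) ^ m` binomially: at a given `a` the sum stops at a bound independent of
`m`, and each `m.choose n` is polynomial in `m`. -/
theorem IsLocallyNilpotent.hasPolynomialPowers {u : WithConv (C →ₗ[k] B)}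
    (hu : IsLocallyNilpotent (u - 1)) : HasPolynomialPowers u := by
  intro a
  obtain ⟨N, hN⟩ := hu a
  refine ⟨∑ n ∈ Finset.range N, Polynomial.C (((u - 1) ^ n) a) * choosePoly k B n, fun m => ?_⟩
  have h1 : (u ^ m) a = ∑ n ∈ Finset.range (m + 1), ((u - 1) ^ n) a * (m.choose n : B) := by
    conv_lhs => rw [← sub_add_cancel u 1, (Commute.one_right (u - 1)).add_pow]
    rw [conv_sum_apply]
    refine Finset.sum_congr rfl fun n _ => ?_
    rw [one_pow, mul_one, ← map_natCast (algebraMap k (WithConv (C →ₗ[k] B))),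
      ← Algebra.commutes, ← Algebra.smul_def, ofConv_smul, LinearMap.smul_apply,
      Algebra.smul_def, map_natCast, mul_comm]
  rw [h1, eval_finsetSum]
  simp only [eval_mul, eval_C, eval_choosePoly]
  -- Both sums extend to a common range: the extra terms vanish by nilpotency on one side and by
  -- vanishing binomial coefficients on the other.
  trans ∑ n ∈ Finset.range (max N (m + 1)), ((u - 1) ^ n) a * (m.choose n : B)
  · refine Finset.sum_subset (Finset.range_mono (le_max_left N (m + 1))) fun n _ hn => ?_
    rw [hN n (by simpa using hn), zero_mul]
  · refine (Finset.sum_subset (Finset.range_mono (le_max_right N (m + 1))) fun n _ hn => ?_).symm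
    rw [Nat.choose_eq_zero_of_lt (by simpa using hn), Nat.cast_zero, mul_zero]

/-- The polynomial `p` with `p(m) = u ^ m (a)`, as a linear function of `a`. -/
def powPoly (u : WithConv (C →ₗ[k] B)) (hu : HasPolynomialPowers u) : C →ₗ[k] B[X] where
  toFun a := (hu a).choose
  map_add' a b := polynomial_eq_of_eval_natCast_eq k fun m => by
    rw [eval_add, (hu _).choose_spec, (hu _).choose_spec, (hu _).choose_spec, map_add]
  map_smul' c a := polynomial_eq_of_eval_natCast_eq k fun m => by
    rw [RingHom.id_apply, eval_smul, (hu _).choose_spec, (hu _).choose_spec, map_smul]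

variable {u : WithConv (C →ₗ[k] B)} (hu : HasPolynomialPowers u)

theorem eval_powPoly (a : C) (m : ℕ) : (powPoly u hu a).eval (m : B) = (u ^ m) a :=
  (hu a).choose_spec m

theorem powPoly_eq {a : C} {p : B[X]} (h : ∀ m : ℕ, p.eval (m : B) = (u ^ m) a) :
    powPoly u hu a = p :=
  polynomial_eq_of_eval_natCast_eq k fun m => by rw [eval_powPoly, h]

theorem coeff_zero_powPoly (a : C) :
    (powPoly u hu a).coeff 0 = algebraMap k B (counit (R := k) a) := by
  have := eval_powPoly hu a 0
  rwa [Nat.cast_zero, pow_zero, ← coeff_zero_eq_eval_zero, LinearMap.convOne_apply] at this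

/-- The logarithm of `u` in the convolution algebra. -/
def convLog (u : WithConv (C →ₗ[k] B)) (hu : HasPolynomialPowers u) : WithConv (C →ₗ[k] B) :=
  toConv (((lcoeff B 1).restrictScalars k) ∘ₗ powPoly u hu)

theorem convLog_apply (a : C) : convLog u hu a = (powPoly u hu a).coeff 1 := rfl

/-- This is the differential equation `E' = log u * E` for `E(X) = u ^ X`, read off from the linear
term of `u ^ (m + n) = u ^ m * u ^ n` in `m`. -/
theorem derivative_powPoly {a : C} {ι : Type*} (r : Repr k a ι) :
    derivative (powPoly u hu a) =
      ∑ i ∈ r.index, Polynomial.C (convLog u hu (r.left i)) * powPoly u hu (r.right i) := by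
  refine polynomial_eq_of_eval_natCast_eq k fun n => ?_
  have hshift : taylor (n : B) (powPoly u hu a) =
      ∑ i ∈ r.index, powPoly u hu (r.left i) * Polynomial.C ((u ^ n) (r.right i)) := by
    refine polynomial_eq_of_eval_natCast_eq k fun m => ?_
    rw [taylor_eval, ← Nat.cast_add, eval_powPoly, eval_finsetSum, pow_add, r.convMul_apply]
    simp [eval_powPoly]
  rw [← taylor_coeff_one, hshift, finsetSum_coeff, eval_finsetSum]
  simp [eval_powPoly, convLog_apply]

/-- Solving the differential equation coefficient by coefficient gives `u ^ X = exp (X log u)`. -/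
theorem coeff_powPoly (a : C) (n : ℕ) :
    (powPoly u hu a).coeff n = (n.factorial : k)⁻¹ • (convLog u hu ^ n) a := by
  induction n generalizing a with
  | zero => simp [coeff_zero_powPoly]
  | succ n ih =>
    have h := congrArg (fun p => p.coeff n) (derivative_powPoly hu (Repr.arbitrary k a))
    simp only [coeff_derivative, finsetSum_coeff, coeff_C_mul, ih, mul_smul_comm] at h
    rw [← Finset.smul_sum, ← (Repr.arbitrary k a).convMul_apply, ← pow_succ'] at h
    have hn : (n : k) + 1 ≠ 0 := Nat.cast_add_one_ne_zero n
    rw [Nat.factorial_succ, Nat.cast_mul, mul_inv, mul_smul, ← h, mul_comm,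
      show ((n : B) + 1) = algebraMap k B ((n : k) + 1) by simp, ← Algebra.smul_def,
      Nat.cast_add_one, inv_smul_smul₀ hn]

/-- An element with polynomial powers is determined by its logarithm. -/
theorem eq_of_convLog_eq {v : WithConv (C →ₗ[k] B)} (hv : HasPolynomialPowers v)
    (h : convLog u hu = convLog v hv) : u = v := by
  ext a
  have hp : powPoly u hu a = powPoly v hv a := by
    ext n
    rw [coeff_powPoly, coeff_powPoly, h]
  have h1 := eval_powPoly hu a 1
  rw [hp, eval_powPoly, pow_one, pow_one] at h1
  exact h1.symm

theorem algHom_comp_convPow {B' : Type*} [CommRing B'] [Algebra k B'] (φ : B →ₐ[k] B')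
    (u : WithConv (C →ₗ[k] B)) (m : ℕ) :
    toConv (φ.toLinearMap ∘ₗ u.ofConv) ^ m = toConv (φ.toLinearMap ∘ₗ (u ^ m).ofConv) := by
  induction m with
  | zero => ext a; simp
  | succ m ih =>
    rw [pow_succ, pow_succ, ih, LinearMap.algHom_comp_convMul_distrib]

/-- Compatibility of powers and logarithms with algebra maps of the target. -/
theorem HasPolynomialPowers.comp {B' : Type*} [CommRing B'] [Algebra k B'] (φ : B →ₐ[k] B')
    (hu : HasPolynomialPowers u) : HasPolynomialPowers (toConv (φ.toLinearMap ∘ₗ u.ofConv)) := by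
  intro a
  refine ⟨(powPoly u hu a).map φ.toRingHom, fun m => ?_⟩
  rw [algHom_comp_convPow, ← map_natCast φ.toRingHom, eval_map_apply, eval_powPoly]
  rfl

theorem convLog_comp {B' : Type*} [CommRing B'] [Algebra k B'] (φ : B →ₐ[k] B')
    (hu : HasPolynomialPowers u) :
    convLog _ (hu.comp φ) = toConv (φ.toLinearMap ∘ₗ (convLog u hu).ofConv) := by
  ext a
  rw [convLog_apply, powPoly_eq (hu.comp φ) (p := (powPoly u hu a).map φ.toRingHom)]
  · rw [coeff_map]
    rfl
  · intro m
    rw [algHom_comp_convPow, ← map_natCast φ.toRingHom, eval_map_apply, eval_powPoly]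
    rfl

end Logarithm

/-! ### Logarithms of algebra and bialgebra maps -/

section LogarithmOfHom

open Polynomial

variable {k : Type*} [Field k] {A : Type*} [CommRing A] [Bialgebra k A]

variable (k A) in
/-- The space of primitive elements. -/
def primitives : Submodule k A where
  carrier := {a | comul (R := k) a = a ⊗ₜ[k] 1 + 1 ⊗ₜ[k] a}
  add_mem' := by
    intro a b ha hb
    simp only [Set.mem_ofPred_eq] at ha hb ⊢
    rw [map_add, ha, hb, TensorProduct.add_tmul, TensorProduct.tmul_add]
    abel
  zero_mem' := by simp
  smul_mem' := by
    intro c a ha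
    simp only [Set.mem_ofPred_eq] at ha ⊢
    rw [map_smul, ha, smul_add, TensorProduct.smul_tmul', TensorProduct.tmul_smul]

theorem mem_primitives {a : A} :
    a ∈ primitives k A ↔ comul (R := k) a = a ⊗ₜ[k] 1 + 1 ⊗ₜ[k] a := Iff.rfl

theorem convMul_apply_of_mem_primitives {B : Type*} [CommRing B] [Algebra k B]
    (f g : WithConv (A →ₗ[k] B)) {p : A} (hp : p ∈ primitives k A) :
    (f * g) p = f p * g 1 + f 1 * g p := by
  rw [LinearMap.convMul_apply, mem_primitives.1 hp]
  simp

theorem convPow_apply_of_isGroupLikeElem {B : Type*} [CommRing B] [Algebra k B]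
    (f : WithConv (A →ₗ[k] B)) {γ : A} (hγ : IsGroupLikeElem k γ) (n : ℕ) :
    (f ^ n) γ = f γ ^ n := by
  induction n with
  | zero => simp [hγ.counit_eq_one]
  | succ n ih =>
    rw [pow_succ, LinearMap.convMul_apply, hγ.comul_eq_tmul_self, pow_succ, ← ih]
    simp

theorem counit_eq_zero_of_mem_primitives {p : A} (hp : p ∈ primitives k A) :
    counit (R := k) p = 0 := by
  have := convMul_apply_of_mem_primitives (1 : WithConv (A →ₗ[k] k)) 1 hp
  simpa using this

variable [CharZero k]

/-- The logarithm of an algebra map is a derivation along the counit. -/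
theorem convLog_mul {B : Type*} [CommRing B] [Algebra k B] (g : A →ₐ[k] B)
    (hg : HasPolynomialPowers (toConv g.toLinearMap)) (a b : A) :
    convLog _ hg (a * b) = algebraMap k B (counit (R := k) a) * convLog _ hg b +
      convLog _ hg a * algebraMap k B (counit (R := k) b) := by
  -- Every convolution power of `g` is again an algebra map, so the interpolating polynomials
  -- multiply; the linear coefficient of a product is the Leibniz rule.
  rw [convLog_apply, powPoly_eq hg (p := powPoly _ hg a * powPoly _ hg b), mul_coeff_one,
    coeff_zero_powPoly, coeff_zero_powPoly]
  · rfl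
  · intro m
    rw [eval_mul, eval_powPoly, eval_powPoly, ← AlgHom.toLinearMap_convPow (toConv g)]
    exact (map_mul (toConv g ^ m).ofConv a b).symm

/-- The logarithm of a bialgebra endomorphism takes values in the primitive elements. -/
theorem convLog_mem_primitives [IsCocomm k A] (e : A →ₐc[k] A)
    (he : HasPolynomialPowers (toConv (e : A →ₐ[k] A).toLinearMap)) (a : A) :
    convLog _ he a ∈ primitives k A := by
  let r := Repr.arbitrary k a
  let Δ : A →ₐ[k] A ⊗[k] A := Bialgebra.comulAlgHom k A
  let i₁ : A →ₐ[k] A ⊗[k] A := Algebra.TensorProduct.includeLeft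
  let i₂ : A →ₐ[k] A ⊗[k] A := Algebra.TensorProduct.includeRight
  have hpow : ∀ (m : ℕ) (a : A), (toConv (e : A →ₐ[k] A).toLinearMap ^ m) a =
      (toConv e ^ m).ofConv a := by
    intro m a
    have h := BialgHom.toLinearMap_convPow (toConv e) m
    exact (congrArg (fun f : WithConv (A →ₗ[k] A) => f a) h).symm
  -- Every convolution power of `e` is a coalgebra map, which becomes an identity of polynomials;
  -- its linear coefficient is primitivity of the logarithm.
  have key : (powPoly _ he a).map Δ.toRingHom = ∑ i ∈ r.index,
      (powPoly _ he (r.left i)).map i₁.toRingHom * (powPoly _ he (r.right i)).map i₂.toRingHom := by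
    refine polynomial_eq_of_eval_natCast_eq k fun m => ?_
    rw [eval_finsetSum, ← map_natCast Δ.toRingHom, eval_map_apply, eval_powPoly, hpow]
    change comul ((toConv e ^ m).ofConv a) = _
    rw [← CoalgHomClass.map_comp_comul_apply, ← r.eq, map_sum]
    refine Finset.sum_congr rfl fun i _ => ?_
    rw [map_natCast Δ.toRingHom, eval_mul]
    conv_rhs =>
      rw [← map_natCast i₁.toRingHom, eval_map_apply, map_natCast i₁.toRingHom,
        ← map_natCast i₂.toRingHom, eval_map_apply]
    rw [eval_powPoly, eval_powPoly, hpow, hpow]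
    simp [i₁, i₂]
  have h1 := congrArg (fun p => p.coeff 1) key
  simp only [coeff_map, finsetSum_coeff, mul_coeff_one, coeff_zero_powPoly] at h1
  rw [mem_primitives]
  have hl : ∑ i ∈ r.index, i₁ (algebraMap k A (counit (R := k) (r.left i))) *
      i₂ (convLog _ he (r.right i)) = 1 ⊗ₜ[k] convLog _ he a := by
    have := sum_counit_smul (R := k) r
    conv_rhs => rw [← this]
    simp [i₁, i₂, TensorProduct.tmul_sum, Algebra.algebraMap_eq_smul_one]
  have hr : ∑ i ∈ r.index, i₁ (convLog _ he (r.left i)) *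
      i₂ (algebraMap k A (counit (R := k) (r.right i))) = convLog _ he a ⊗ₜ[k] 1 := by
    have := congrArg (TensorProduct.rid k A) (sum_tmul_counit_eq (R := k) r)
    simp only [map_sum, TensorProduct.rid_tmul, one_smul] at this
    conv_rhs => rw [← this]
    simp [i₁, i₂, TensorProduct.sum_tmul, Algebra.algebraMap_eq_smul_one,
      TensorProduct.smul_tmul]
  refine h1.trans ?_
  rw [Finset.sum_add_distrib, add_comm]
  exact congrArg₂ (· + ·) hr hl

end LogarithmOfHom

/-! ### Exponentials of derivations along the counit -/

section Exponential

variable {k : Type*} [Field k] [CharZero k] {A : Type*} [CommRing A] [Bialgebra k A]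
  {B : Type*} [CommRing B] [Algebra k B]

/-- The external product `(f ⊠ g) (a ⊗ b) = f a * g b`. -/
def boxMul (f g : WithConv (A →ₗ[k] B)) : WithConv (A ⊗[k] A →ₗ[k] B) :=
  toConv ((Algebra.TensorProduct.lmul' k (S := B)).toLinearMap ∘ₗ
    TensorProduct.map f.ofConv g.ofConv)

theorem boxMul_tmul (f g : WithConv (A →ₗ[k] B)) (a b : A) :
    boxMul f g (a ⊗ₜ b) = f a * g b := by
  simp [boxMul]

/-- The two tensor factors convolve independently, and multiplication on the commutative ring `B` is
an algebra map. -/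
theorem boxMul_mul_boxMul (f g f' g' : WithConv (A →ₗ[k] B)) :
    boxMul f g * boxMul f' g' = boxMul (f * f') (g * g') := by
  have := LinearMap.algHom_comp_convMul_distrib (Algebra.TensorProduct.lmul' k (S := B))
    (toConv (TensorProduct.map f.ofConv g.ofConv))
    (toConv (TensorProduct.map f'.ofConv g'.ofConv))
  rw [TensorProduct.map_convMul_map] at this
  exact (congrArg toConv this).symm

theorem boxMul_one_one : boxMul (1 : WithConv (A →ₗ[k] B)) 1 = 1 := by
  ext a b
  change boxMul (1 : WithConv (A →ₗ[k] B)) 1 (a ⊗ₜ b) = (1 : WithConv (A ⊗[k] A →ₗ[k] B)) (a ⊗ₜ b)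
  rw [boxMul_tmul]
  simp [mul_comm]

theorem boxMul_pow (f g : WithConv (A →ₗ[k] B)) (n : ℕ) :
    boxMul f g ^ n = boxMul (f ^ n) (g ^ n) := by
  induction n with
  | zero => simp [boxMul_one_one]
  | succ n ih => rw [pow_succ, ih, boxMul_mul_boxMul, pow_succ, pow_succ]

/-- The Leibniz rule for convolution powers. -/
theorem convPow_mul (d : WithConv (A →ₗ[k] B))
    (hd : ∀ a b, d (a * b) = algebraMap k B (counit (R := k) a) * d b +
      d a * algebraMap k B (counit (R := k) b)) (n : ℕ) (a b : A) :
    (d ^ n) (a * b) = ∑ ij ∈ Finset.HasAntidiagonal.antidiagonal n,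
      (n.choose ij.1 : k) • ((d ^ ij.1) a * (d ^ ij.2) b) := by
  -- Multiplication of `A` is a coalgebra map, so precomposition with it preserves convolution
  -- powers.
  have hpow : toConv (d.ofConv ∘ₗ LinearMap.mul' k A) ^ n =
      toConv ((d ^ n).ofConv ∘ₗ LinearMap.mul' k A) := by
    induction n with
    | zero => ext a b; simp [mul_comm]
    | succ n ih =>
      rw [pow_succ, ih, pow_succ]
      exact (congrArg toConv
        (LinearMap.convMul_comp_coalgHom_distrib (d ^ n) d (Bialgebra.mulCoalgHom k A))).symm
  -- The Leibniz rule presents this composite as a sum of two commuting elements, to which the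
  -- binomial theorem applies.
  have hsum : toConv (d.ofConv ∘ₗ LinearMap.mul' k A) = boxMul d 1 + boxMul 1 d := by
    ext a b
    change d (a * b) = boxMul d 1 (a ⊗ₜ b) + boxMul 1 d (a ⊗ₜ b)
    rw [boxMul_tmul, boxMul_tmul, hd, add_comm]
    rfl
  have hcomm : Commute (boxMul d (1 : WithConv (A →ₗ[k] B))) (boxMul 1 d) := by
    rw [commute_iff_eq, boxMul_mul_boxMul, boxMul_mul_boxMul]
    simp
  rw [hsum, hcomm.add_pow'] at hpow
  have := congrArg (fun f : WithConv (A ⊗[k] A →ₗ[k] B) => f (a ⊗ₜ b)) hpow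
  simp only at this
  refine Eq.trans this.symm ?_
  rw [conv_sum_apply]
  refine Finset.sum_congr rfl fun ij _ => ?_
  rw [boxMul_pow, boxMul_pow, boxMul_mul_boxMul, one_pow, one_pow, one_mul, mul_one,
    ← Nat.cast_smul_eq_nsmul k, ofConv_smul, LinearMap.smul_apply, boxMul_tmul]

/-- A locally nilpotent derivation along the counit has an exponential. -/
theorem exists_algHom_eq_exp (d : WithConv (A →ₗ[k] B)) (hn : IsLocallyNilpotent d)
    (hd : ∀ a b, d (a * b) = algebraMap k B (counit (R := k) a) * d b +
      d a * algebraMap k B (counit (R := k) b)) :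
    ∃ g : A →ₐ[k] B, ∀ a N, (∀ m, N ≤ m → (d ^ m) a = 0) →
      g a = ∑ n ∈ Finset.range N, (n.factorial : k)⁻¹ • (d ^ n) a := by
  have hcoeff : ∀ a N, (∀ m, N ≤ m → (d ^ m) a = 0) → ∀ n,
      (∑ n ∈ Finset.range N, Polynomial.monomial n ((n.factorial : k)⁻¹ • (d ^ n) a)).coeff n =
        (n.factorial : k)⁻¹ • (d ^ n) a := by
    intro a N hN n
    rw [Polynomial.finsetSum_coeff]
    simp only [Polynomial.coeff_monomial, Finset.sum_ite_eq', Finset.mem_range]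
    split_ifs with h
    · rfl
    · rw [hN n (not_lt.1 h), smul_zero]
  -- Form `exp (X d)` with values in `B[X]` first: its multiplicativity is checked on coefficients
  -- without truncation bounds, and setting `X = 1` then gives `exp d`.
  have hex : ∀ a, ∃ p : Polynomial B, ∀ n, p.coeff n = (n.factorial : k)⁻¹ • (d ^ n) a :=
    fun a => ⟨_, hcoeff a _ (hn a).choose_spec⟩
  choose E hE using hex
  have hd1 : d 1 = 0 := by simpa using hd 1 1
  have hone : E 1 = 1 := by
    ext n
    rw [hE, convPow_apply_of_isGroupLikeElem _ .one, hd1]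
    rcases n with _ | n
    · simp
    · simp [Polynomial.coeff_one]
  let EL : A →ₐ[k] Polynomial B := AlgHom.ofLinearMap
    { toFun := E
      map_add' := fun a b => by ext n; simp [hE]
      map_smul' := fun c a => by ext n; simp [hE, smul_comm c] }
    hone
    (fun a b => by
      ext n
      change (E (a * b)).coeff n = (E a * E b).coeff n
      rw [hE, convPow_mul d hd, Polynomial.coeff_mul, Finset.smul_sum]
      refine Finset.sum_congr rfl fun ij hij => ?_
      rw [Finset.HasAntidiagonal.mem_antidiagonal] at hij
      rw [hE, hE, smul_smul, smul_mul_smul_comm]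
      congr 1
      rw [← hij, Nat.cast_add_choose]
      have := Nat.cast_ne_zero (R := k).2 (ij.1 + ij.2).factorial_ne_zero
      field_simp)
  refine ⟨((Polynomial.aeval (R := B) (1 : B)).restrictScalars k ).comp EL, fun a N hN => ?_⟩
  change Polynomial.aeval (R := B) (1 : B) (E a) = _
  rw [show E a = _ from Polynomial.ext fun n => (hE a n).trans (hcoeff a N hN n).symm, map_sum]
  simp

end Exponential

/-! ### The unipotent part -/

section UnipotentPart

variable {k : Type*} [Field k] {A : Type*} [CommRing A] [HopfAlgebra k A] [IsCocomm k A]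

/-- A functional `f` with `f 1 = 0` sends `p` to `f(p) · 1`, which has level one; so `p` has level
two. -/
theorem mem_weightSpace_one_of_mem_primitives {p : A} (hp : p ∈ primitives k A) :
    p ∈ weightSpace (1 : GroupLike k A) := by
  refine mem_weightSpace.2 ⟨2, mem_weightFiltration_succ.2 fun f hf => ?_⟩
  have hf1 : f (1 : A) = 0 := mem_weightIdeal.1 hf
  rw [dual_smul_def, mem_primitives.1 hp, map_add, contractRight_tmul, contractRight_tmul, hf1,
    zero_smul, zero_add]
  exact ((weightFiltration (1 : GroupLike k A) 1).restrictScalars k).smul_mem _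
    (val_mem_weightFiltration_one 1)

variable [IsAlgClosed k]

variable (k A) in
/-- The bialgebra retraction of `A` onto the group algebra of its group-like elements. -/
def groupLikeRetraction : A →ₐc[k] MonoidAlgebra k (GroupLike k A) :=
  (exists_groupLikeRetraction k A).choose

theorem groupLikeRetraction_of_mem {γ : GroupLike k A} {a : A} (ha : a ∈ weightSpace γ) :
    groupLikeRetraction k A a = MonoidAlgebra.single γ (counit (R := k) a) :=
  (exists_groupLikeRetraction k A).choose_spec γ a ha

theorem groupLikeRetraction_val (γ : GroupLike k A) :
    groupLikeRetraction k A γ.val = MonoidAlgebra.single γ 1 := by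
  rw [groupLikeRetraction_of_mem (val_mem_weightSpace γ), γ.2.counit_eq_one]

theorem groupLikeRetraction_of_mem_primitives {p : A} (hp : p ∈ primitives k A) :
    groupLikeRetraction k A p = 0 := by
  rw [groupLikeRetraction_of_mem (mem_weightSpace_one_of_mem_primitives hp),
    counit_eq_zero_of_mem_primitives hp, MonoidAlgebra.single_zero]

variable (k A) in
/-- The inclusion of the group algebra of the group-like elements. -/
abbrev groupLikeInclusion : MonoidAlgebra k (GroupLike k A) →ₐc[k] A :=
  MonoidAlgebra.liftGroupLikeBialgHom

variable (k A) in
/-- The inverse of the inclusion of the group algebra, for the convolution product. -/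
def groupLikeInclusionInv : MonoidAlgebra k (GroupLike k A) →ₐc[k] A :=
  (groupLikeInclusion k A).comp (MonoidAlgebra.mapDomainBialgHom k invMonoidHom)

theorem groupLikeInclusion_single (γ : GroupLike k A) :
    groupLikeInclusion k A (MonoidAlgebra.single γ 1) = γ.val := by
  simp

theorem groupLikeInclusionInv_single (γ : GroupLike k A) :
    groupLikeInclusionInv k A (MonoidAlgebra.single γ 1) = (γ⁻¹).val := by
  simp [groupLikeInclusionInv]

variable (k A) in
/-- The projection of `A` onto the coordinate ring of the unipotent part. -/
def unipotentProj : A →ₐc[k] A :=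
  (toConv (BialgHom.id k A) *
    toConv ((groupLikeInclusionInv k A).comp (groupLikeRetraction k A))).ofConv

/-- The underlying element of the convolution algebra of the unipotent projection. -/
abbrev unipotentProjConv (k A : Type*) [Field k] [CommRing A] [HopfAlgebra k A] [IsCocomm k A]
    [IsAlgClosed k] : WithConv (A →ₗ[k] A) :=
  toConv (unipotentProj k A : A →ₐ[k] A).toLinearMap

theorem unipotentProjConv_eq : unipotentProjConv k A = toConv LinearMap.id *
    toConv ((groupLikeInclusionInv k A : MonoidAlgebra k (GroupLike k A) →ₐ[k] A).toLinearMap ∘ₗ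
      (groupLikeRetraction k A : A →ₐ[k] MonoidAlgebra k (GroupLike k A)).toLinearMap) := rfl

/-- On `k[Γ]` the inclusion and its composite with inversion are convolution inverses, because `γ⁻¹
γ = 1`; pulling back along `r` cancels the second factor of the projection. -/
theorem unipotentProj_mul_inclusion_comp_retraction :
    unipotentProjConv k A * toConv ((groupLikeInclusion k A : MonoidAlgebra k (GroupLike k A) →ₐ[k] A).toLinearMap ∘ₗ
      (groupLikeRetraction k A : A →ₐ[k] MonoidAlgebra k (GroupLike k A)).toLinearMap) = toConv LinearMap.id := by
  have h1 : toConv (groupLikeInclusionInv k A : MonoidAlgebra k (GroupLike k A) →ₐ[k] A).toLinearMap *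
      toConv (groupLikeInclusion k A : MonoidAlgebra k (GroupLike k A) →ₐ[k] A).toLinearMap = 1 := by
    apply WithConv.ext
    refine MonoidAlgebra.lhom_ext' fun γ => LinearMap.ext_ring ?_
    rw [LinearMap.comp_apply, LinearMap.comp_apply, MonoidAlgebra.lsingle_apply]
    rw [LinearMap.convMul_apply, (MonoidAlgebra.isGroupLikeElem_single_one γ).comul_eq_tmul_self,
      LinearMap.convOne_apply, (MonoidAlgebra.isGroupLikeElem_single_one γ).counit_eq_one]
    change groupLikeInclusionInv k A (MonoidAlgebra.single γ 1) *
      groupLikeInclusion k A (MonoidAlgebra.single γ 1) = _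
    rw [groupLikeInclusion_single, groupLikeInclusionInv_single, ← GroupLike.val_mul,
      inv_mul_cancel]
    simp
  have h2 := LinearMap.convMul_comp_coalgHom_distrib
    (toConv (groupLikeInclusionInv k A : MonoidAlgebra k (GroupLike k A) →ₐ[k] A).toLinearMap)
    (toConv (groupLikeInclusion k A : MonoidAlgebra k (GroupLike k A) →ₐ[k] A).toLinearMap)
    (groupLikeRetraction k A : A →ₗc[k] MonoidAlgebra k (GroupLike k A))
  rw [h1] at h2
  rw [unipotentProjConv_eq, mul_assoc]
  refine (congrArg (toConv LinearMap.id * ·) (congrArg toConv h2).symm).trans ?_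
  have h3 : toConv ((1 : WithConv (MonoidAlgebra k (GroupLike k A) →ₗ[k] A)).ofConv ∘ₗ
      (groupLikeRetraction k A : A →ₗc[k] MonoidAlgebra k (GroupLike k A)).toLinearMap) =
      (1 : WithConv (A →ₗ[k] A)) := by
    ext a
    exact congrArg (algebraMap k A) (CoalgHomClass.counit_comp_apply (groupLikeRetraction k A) a)
  rw [h3, mul_one]

theorem unipotentProj_val (γ : GroupLike k A) : unipotentProjConv k A γ.val = 1 := by
  rw [unipotentProjConv_eq, LinearMap.convMul_apply, γ.2.comul_eq_tmul_self]
  change γ.val * groupLikeInclusionInv k A (groupLikeRetraction k A γ.val) = 1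
  rw [groupLikeRetraction_val, groupLikeInclusionInv_single, ← GroupLike.val_mul, mul_inv_cancel,
    GroupLike.val_one]

variable [CharZero k]

theorem unipotentProj_of_mem_primitives {p : A} (hp : p ∈ primitives k A) :
    unipotentProjConv k A p = p := by
  rw [unipotentProjConv_eq, convMul_apply_of_mem_primitives _ _ hp]
  change p * groupLikeInclusionInv k A (groupLikeRetraction k A 1) +
    1 * groupLikeInclusionInv k A (groupLikeRetraction k A p) = p
  rw [groupLikeRetraction_of_mem_primitives hp]
  simp

variable (k A) in
-- The projection and the convolution unit agree on group-like elements, so their difference is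
-- locally nilpotent.
theorem hasPolynomialPowers_unipotentProj : HasPolynomialPowers (unipotentProjConv k A) := by
  refine IsLocallyNilpotent.hasPolynomialPowers (exists_convPow_eq_zero _ fun γ => ?_)
  rw [ofConv_sub, LinearMap.sub_apply, unipotentProj_val, LinearMap.convOne_apply,
    γ.2.counit_eq_one, map_one, sub_self]

variable (k A) in
/-- The logarithm of the unipotent projection. -/
def unipotentLog : WithConv (A →ₗ[k] A) :=
  convLog _ (hasPolynomialPowers_unipotentProj k A)

theorem unipotentLog_mem_primitives (a : A) : unipotentLog k A a ∈ primitives k A :=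
  convLog_mem_primitives _ (hasPolynomialPowers_unipotentProj k A) a

theorem unipotentLog_val (γ : GroupLike k A) : unipotentLog k A γ.val = 0 := by
  rw [unipotentLog, convLog_apply, powPoly_eq _ (p := 1), Polynomial.coeff_one]
  · simp
  · intro m
    rw [convPow_apply_of_isGroupLikeElem _ γ.2, unipotentProj_val]
    simp

/-- On a primitive `p` the `m`-th convolution power of the projection is `m p`, interpolated by `p
X`. -/
theorem unipotentLog_of_mem_primitives {p : A} (hp : p ∈ primitives k A) :
    unipotentLog k A p = p := by
  rw [unipotentLog, convLog_apply, powPoly_eq _ (p := Polynomial.C p * Polynomial.X)]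
  · simp
  · intro m
    rw [Polynomial.eval_mul, Polynomial.eval_C, Polynomial.eval_X]
    induction m with
    | zero => simp [counit_eq_zero_of_mem_primitives hp]
    | succ m ih =>
      have h1 : unipotentProjConv k A (1 : A) = 1 := unipotentProj_val (1 : GroupLike k A)
      rw [pow_succ, convMul_apply_of_mem_primitives _ _ hp, ← ih,
        convPow_apply_of_isGroupLikeElem _ .one, h1, unipotentProj_of_mem_primitives hp]
      push_cast
      ring

variable {B : Type*} [CommRing B] [Algebra k B]

/-- An algebra map is determined by its values on primitive and group-like elements. -/
theorem algHom_ext_of_primitives_of_groupLike {g g' : A →ₐ[k] B}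
    (hP : ∀ p ∈ primitives k A, g p = g' p) (hΓ : ∀ γ : GroupLike k A, g γ.val = g' γ.val) :
    g = g' := by
  -- Compose `g` with the factorization of the identity: the second convolution factor sees only the
  -- group-like elements.
  have hdec : ∀ g : A →ₐ[k] B, toConv g.toLinearMap =
      toConv (g.toLinearMap ∘ₗ (unipotentProjConv k A).ofConv) *
        toConv (((g.comp (groupLikeInclusion k A : MonoidAlgebra k (GroupLike k A) →ₐ[k] A)).toLinearMap) ∘ₗ
          (groupLikeRetraction k A : A →ₐ[k] MonoidAlgebra k (GroupLike k A)).toLinearMap) := by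
    intro g
    have h := LinearMap.algHom_comp_convMul_distrib g (unipotentProjConv k A)
      (toConv ((groupLikeInclusion k A : MonoidAlgebra k (GroupLike k A) →ₐ[k] A).toLinearMap ∘ₗ
        (groupLikeRetraction k A : A →ₐ[k] MonoidAlgebra k (GroupLike k A)).toLinearMap))
    rw [unipotentProj_mul_inclusion_comp_retraction] at h
    exact congrArg toConv h
  -- The first factor is determined by its logarithm, which is `g` applied to primitive elements.
  have hlog : toConv (g.toLinearMap ∘ₗ (unipotentProjConv k A).ofConv) =
      toConv (g'.toLinearMap ∘ₗ (unipotentProjConv k A).ofConv) := by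
    refine eq_of_convLog_eq ((hasPolynomialPowers_unipotentProj k A).comp g)
      ((hasPolynomialPowers_unipotentProj k A).comp g') ?_
    rw [convLog_comp _ (hasPolynomialPowers_unipotentProj k A),
      convLog_comp _ (hasPolynomialPowers_unipotentProj k A)]
    ext a
    exact hP _ (unipotentLog_mem_primitives a)
  have hχ : g.comp (groupLikeInclusion k A : MonoidAlgebra k (GroupLike k A) →ₐ[k] A) =
      g'.comp (groupLikeInclusion k A : MonoidAlgebra k (GroupLike k A) →ₐ[k] A) := by
    refine MonoidAlgebra.algHom_ext' (MonoidHom.ext fun γ => ?_) (by ext)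
    change g (groupLikeInclusion k A (MonoidAlgebra.single γ 1)) =
      g' (groupLikeInclusion k A (MonoidAlgebra.single γ 1))
    rw [groupLikeInclusion_single, hΓ]
  apply AlgHom.toLinearMap_injective
  apply toConv_injective
  rw [hdec g, hdec g', hlog, hχ]

/-- Values on primitive and group-like elements can be prescribed. -/
theorem exists_algHom_of_primitives_of_groupLike (l : primitives k A →ₗ[k] B)
    (χ : MonoidAlgebra k (GroupLike k A) →ₐ[k] B) :
    ∃ g : A →ₐ[k] B, (∀ p : primitives k A, g p = l p) ∧
      ∀ γ : GroupLike k A, g γ.val = χ (MonoidAlgebra.single γ 1) := by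
  let d : WithConv (A →ₗ[k] B) := toConv (l ∘ₗ
    (unipotentLog k A).ofConv.codRestrict (primitives k A) unipotentLog_mem_primitives)
  have hdΓ : ∀ γ : GroupLike k A, d γ.val = 0 := by
    intro γ
    change l ⟨unipotentLog k A γ.val, _⟩ = 0
    rw [← map_zero l]
    exact congrArg l (Subtype.ext (unipotentLog_val γ))
  have hd1 : d 1 = 0 := hdΓ 1
  have hdP : ∀ p : primitives k A, d p.1 = l p := fun p =>
    congrArg l (Subtype.ext (unipotentLog_of_mem_primitives p.2))
  obtain ⟨g₀, hg₀⟩ := exists_algHom_eq_exp d (exists_convPow_eq_zero d hdΓ) fun a b => by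
    have h : (⟨unipotentLog k A (a * b), unipotentLog_mem_primitives _⟩ : primitives k A) =
        counit (R := k) a • ⟨unipotentLog k A b, unipotentLog_mem_primitives _⟩ +
        counit (R := k) b • ⟨unipotentLog k A a, unipotentLog_mem_primitives _⟩ := by
      apply Subtype.ext
      refine (convLog_mul _ (hasPolynomialPowers_unipotentProj k A) a b).trans ?_
      rw [mul_comm (convLog _ _ a), ← Algebra.smul_def, ← Algebra.smul_def]
      rfl
    have h2 := congrArg l h
    rw [map_add, map_smul, map_smul] at h2
    refine h2.trans ?_
    rw [mul_comm (d a), ← Algebra.smul_def, ← Algebra.smul_def]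
    rfl
  have hg₀Γ : ∀ γ : GroupLike k A, g₀ γ.val = 1 := by
    intro γ
    rw [hg₀ γ.val 1]
    · simp [γ.2.counit_eq_one]
    · intro m hm
      rw [convPow_apply_of_isGroupLikeElem _ γ.2, hdΓ, zero_pow (by omega)]
  have hg₀P : ∀ p : primitives k A, g₀ p = l p := by
    intro p
    -- Two terms suffice: `d 1 = 0` makes every power of `d` from the second on vanish on
    -- primitives.
    rw [hg₀ p 2]
    · simp [Finset.sum_range_succ, counit_eq_zero_of_mem_primitives p.2, hdP]
    · intro m hm
      obtain ⟨m, rfl⟩ : ∃ n, m = n + 1 + 1 := ⟨m - 2, by omega⟩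
      rw [pow_succ, convMul_apply_of_mem_primitives _ _ p.2, hd1,
        convPow_apply_of_isGroupLikeElem _ .one, hd1]
      simp
  -- This factor supplies the values on group-like elements and vanishes on primitives, so
  -- multiplying by it leaves the values of `g₀` there unchanged.
  let h : A →ₐ[k] B := χ.comp (groupLikeRetraction k A : A →ₐ[k] MonoidAlgebra k (GroupLike k A))
  have hval : ∀ a, (toConv g₀ * toConv h).ofConv a =
      (toConv g₀.toLinearMap * toConv h.toLinearMap) a := fun a => rfl
  refine ⟨(toConv g₀ * toConv h).ofConv, fun p => ?_, fun γ => ?_⟩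
  · rw [hval, convMul_apply_of_mem_primitives _ _ p.2]
    have hp : h p = 0 := by
      change χ (groupLikeRetraction k A p) = 0
      rw [groupLikeRetraction_of_mem_primitives p.2, map_zero]
    simp [hp, hg₀P]
  · rw [hval, LinearMap.convMul_apply, γ.2.comul_eq_tmul_self]
    have hγ : h γ.val = χ (MonoidAlgebra.single γ 1) := by
      change χ (groupLikeRetraction k A γ.val) = _
      rw [groupLikeRetraction_val]
    simp [hγ, hg₀Γ]

end UnipotentPart

/-! ### Group algebras are diagonalizable -/

section Diagonalizable

variable {k : Type u} [Field k] {A : Type u} [CommRing A] [HopfAlgebra k A]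
  {V : Type u} [AddCommGroup V] [Module k V]

/-- Contracting the coaction with functionals, in terms of the dual action on `A`. -/
theorem LinRep.coact_contractRight (ρ : LinRep k A V) (f : A →ₗ[k] k) (v : V) :
    ρ.coact (contractRight V f (ρ.coact v)) =
      (contractRight A f ∘ₗ comul).lTensor V (ρ.coact v) := by
  have h := congrArg ((contractRight A f).lTensor V) (ρ.coassoc v)
  rw [← LinearMap.comp_apply (LinearMap.lTensor V _), ← LinearMap.lTensor_comp] at h
  rw [← h]
  generalize ρ.coact v = z
  induction z using TensorProduct.induction_on with
  | zero => simp
  | add x y hx hy => simp only [map_add, hx, hy]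
  | tmul v a =>
    rw [contractRight_tmul, map_smul, LinearMap.rTensor_tmul]
    generalize ρ.coact v = w
    induction w using TensorProduct.induction_on with
    | zero => simp
    | add x y hx hy => simp only [TensorProduct.add_tmul, map_add, smul_add, hx, hy]
    | tmul v b => simp [TensorProduct.tmul_smul]

/-- The weight space of weight `γ` of a representation. -/
def LinRep.weightSpace (ρ : LinRep k A V) (γ : A) : Submodule k V where
  carrier := {v | ρ.coact v = v ⊗ₜ γ}
  add_mem' := by
    intro v w hv hw
    simp only [Set.mem_ofPred_eq] at hv hw ⊢
    rw [map_add, hv, hw, TensorProduct.add_tmul]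
  zero_mem' := by simp
  smul_mem' := by
    intro c v hv
    simp only [Set.mem_ofPred_eq] at hv ⊢
    rw [map_smul, hv, TensorProduct.smul_tmul']

theorem LinRep.mem_weightSpace {ρ : LinRep k A V} {γ : A} {v : V} :
    v ∈ ρ.weightSpace γ ↔ ρ.coact v = v ⊗ₜ γ := Iff.rfl

variable {Γ : Type u} [CommGroup Γ]

/-- The coefficient of a group element, as a functional on the group algebra. -/
def groupAlgebraCoord (γ : Γ) : MonoidAlgebra k Γ →ₗ[k] k :=
  Finsupp.lapply γ ∘ₗ (MonoidAlgebra.coeffLinearEquiv k).toLinearMap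

theorem groupAlgebraCoord_single [DecidableEq Γ] (γ δ : Γ) (c : k) :
    groupAlgebraCoord γ (MonoidAlgebra.single δ c) = if δ = γ then c else 0 := by
  simp [groupAlgebraCoord, Finsupp.single_apply]

/-- The coordinate functional at `γ` acts on `k[Γ]` as the projection onto the line of `γ`;
coassociativity transfers this to `V`. -/
theorem contractRight_groupAlgebraCoord_mem_weightSpace
    (ρ : LinRep k (MonoidAlgebra k Γ) V) (γ : Γ) (v : V) :
    contractRight V (groupAlgebraCoord γ) (ρ.coact v) ∈
      ρ.weightSpace (MonoidAlgebra.single γ 1) := by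
  classical
  rw [LinRep.mem_weightSpace, LinRep.coact_contractRight]
  have h : contractRight (MonoidAlgebra k Γ) (groupAlgebraCoord (k := k) γ) ∘ₗ comul =
      (groupAlgebraCoord γ).smulRight (MonoidAlgebra.single γ 1) := by
    refine MonoidAlgebra.lhom_ext' fun δ => LinearMap.ext_ring ?_
    rw [LinearMap.comp_apply, LinearMap.comp_apply, LinearMap.comp_apply,
      MonoidAlgebra.lsingle_apply,
      (MonoidAlgebra.isGroupLikeElem_single_one δ).comul_eq_tmul_self, contractRight_tmul,
      LinearMap.smulRight_apply, groupAlgebraCoord_single]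
    split_ifs with h
    · rw [h]
    · simp
  rw [h]
  generalize ρ.coact v = z
  induction z using TensorProduct.induction_on with
  | zero => simp
  | add x y hx hy => simp only [map_add, hx, hy, TensorProduct.add_tmul]
  | tmul v a =>
    rw [LinearMap.lTensor_tmul, LinearMap.smulRight_apply, contractRight_tmul,
      TensorProduct.smul_tmul]

/-- The counit of `k[Γ]` is the sum of the coordinate functionals, so the counit axiom writes `v` as
the sum of its weight components. -/
theorem iSup_weightSpace_groupAlgebra (ρ : LinRep k (MonoidAlgebra k Γ) V) :
    ⨆ γ : Γ, ρ.weightSpace (MonoidAlgebra.single γ 1) = ⊤ := by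
  classical
  rw [eq_top_iff]
  intro v _
  have key : ∀ z : V ⊗[k] MonoidAlgebra k Γ,
      (∀ γ, contractRight V (groupAlgebraCoord γ) z ∈ ρ.weightSpace (MonoidAlgebra.single γ 1)) →
      TensorProduct.rid k V ((counit (R := k)).lTensor V z) ∈
        ⨆ γ : Γ, ρ.weightSpace (MonoidAlgebra.single γ 1) := by
    intro z hz
    have hsum : ∃ s : Finset Γ, TensorProduct.rid k V ((counit (R := k)).lTensor V z) =
        ∑ γ ∈ s, contractRight V (groupAlgebraCoord γ) z := by
      clear hz
      -- Allowing every larger finite set makes the claim additive in `z`.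
      have hs : ∃ s : Finset Γ, ∀ t, s ⊆ t →
          TensorProduct.rid k V ((counit (R := k)).lTensor V z) =
          ∑ γ ∈ t, contractRight V (groupAlgebraCoord γ) z := by
        induction z using TensorProduct.induction_on with
        | zero => exact ⟨∅, by simp⟩
        | add x y hx hy =>
          obtain ⟨s, hs⟩ := hx
          obtain ⟨t, ht⟩ := hy
          refine ⟨s ∪ t, fun r hr => ?_⟩
          rw [map_add, map_add, hs r (Finset.union_subset_left hr),
            ht r (Finset.union_subset_right hr), ← Finset.sum_add_distrib]
          simp
        | tmul v a =>
          induction a using MonoidAlgebra.induction_linear with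
          | zero => exact ⟨∅, by simp⟩
          | add x y hx hy =>
            obtain ⟨s, hs⟩ := hx
            obtain ⟨t, ht⟩ := hy
            refine ⟨s ∪ t, fun r hr => ?_⟩
            rw [TensorProduct.tmul_add, map_add, map_add, hs r (Finset.union_subset_left hr),
              ht r (Finset.union_subset_right hr), ← Finset.sum_add_distrib]
            simp
          | single γ c =>
            refine ⟨{γ}, fun t ht => ?_⟩
            have hγ : γ ∈ t := ht (Finset.mem_singleton_self γ)
            simp [groupAlgebraCoord_single, ite_smul, hγ]
      obtain ⟨s, hs⟩ := hs
      exact ⟨s, hs s subset_rfl⟩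
    obtain ⟨s, hs⟩ := hsum
    rw [hs]
    exact Submodule.sum_mem _ fun γ _ => Submodule.mem_iSup_of_mem γ (hz γ)
  have := key (ρ.coact v) fun γ => contractRight_groupAlgebraCoord_mem_weightSpace ρ γ v
  rwa [ρ.counit] at this

theorem iSupIndep_weightSpace_groupAlgebra (ρ : LinRep k (MonoidAlgebra k Γ) V) :
    iSupIndep fun γ : Γ => ρ.weightSpace (MonoidAlgebra.single γ 1) := by
  classical
  rw [iSupIndep_iff_finsetSum_eq_zero_imp_eq_zero]
  intro s v hv hs γ hγ
  have h := congrArg (fun w => contractRight V (groupAlgebraCoord γ) (ρ.coact w)) hs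
  simp only [map_sum, map_zero] at h
  rw [Finset.sum_eq_single_of_mem γ hγ, LinRep.mem_weightSpace.1 (hv γ hγ), contractRight_tmul,
    groupAlgebraCoord_single, if_pos rfl, one_smul] at h
  · exact h
  · intro δ hδ hne
    rw [LinRep.mem_weightSpace.1 (hv δ hδ), contractRight_tmul, groupAlgebraCoord_single,
      if_neg hne, zero_smul]

variable (k Γ) in
/-- The group algebra of a commutative group is the coordinate ring of a diagonalizable group. -/
theorem isDiagonalizable_groupAlgebra : IsDiagonalizable k (MonoidAlgebra k Γ) := by
  classical
  intro V _ _ ρ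
  have hint : DirectSum.IsInternal fun γ : Γ => ρ.weightSpace (MonoidAlgebra.single γ 1) :=
    DirectSum.isInternal_submodule_of_iSupIndep_of_iSup_eq_top
      (iSupIndep_weightSpace_groupAlgebra ρ) (iSup_weightSpace_groupAlgebra ρ)
  -- Every vector of a basis adapted to the weight decomposition spans a stable line.
  let b := hint.collectedBasis fun γ => Module.Basis.ofVectorSpace k _
  refine ⟨_, fun i => Submodule.span k {b i}, fun i => ⟨fun v hv => ?_, ?_⟩, ?_, ?_⟩
  · have hmem : b i ∈ ρ.weightSpace (MonoidAlgebra.single i.1 1) :=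
      hint.collectedBasis_mem _ i
    have hv' : v ∈ ρ.weightSpace (MonoidAlgebra.single i.1 1) :=
      (Submodule.span_singleton_le_iff_mem _ _).2 hmem hv
    rw [LinRep.mem_weightSpace.1 hv']
    exact ⟨(⟨v, hv⟩ : Submodule.span k {b i}) ⊗ₜ MonoidAlgebra.single i.1 1, rfl⟩
  · exact finrank_span_singleton (b.ne_zero i)
  · exact b.linearIndependent.iSupIndep_span_singleton
  · rw [← Submodule.span_range_eq_iSup, b.span_eq]

end Diagonalizable

/-! ### The regular representation of a unipotent group -/

section Unipotent

variable {k : Type u} [Field k] {A : Type u} [CommRing A] [HopfAlgebra k A]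

variable (k A) in
/-- The regular representation. -/
def regularRep : LinRep k A A where
  coact := comul
  coassoc := coassoc_apply
  counit a := by simp

/-- Every nonzero stable subspace of the regular representation of a unipotent group
contains the unit. -/
theorem IsUnipotent.one_mem_of_isStable (h : IsUnipotent k A) {W : Submodule k A}
    (hW : (regularRep k A).IsStable W) (hne : W ≠ ⊥) : (1 : A) ∈ W := by
  obtain ⟨F, hF0, hFmono, hFtop, -, hFtriv⟩ := h A (regularRep k A)
  obtain ⟨w, hw, hw0⟩ := Submodule.exists_mem_ne_zero_of_ne_bot hne
  have hex : ∃ n, ∃ c ∈ W, c ≠ 0 ∧ c ∈ F n := by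
    have : w ∈ ⨆ n, F n := by rw [hFtop]; trivial
    obtain ⟨n, hn⟩ := (Submodule.mem_iSup_of_directed _ hFmono.directed_le).1 this
    exact ⟨n, w, hw, hw0, hn⟩
  classical
  -- Choose a nonzero element of `W` at the lowest possible filtration level; minimality will force
  -- it to be invariant.
  obtain ⟨c, hcW, hc0, hcF⟩ := Nat.find_spec hex
  have hmin := fun m => Nat.find_min hex (m := m)
  generalize Nat.find hex = n at hcF hmin
  rcases n with _ | n
  · rw [hF0] at hcF
    exact absurd ((Submodule.mem_bot k).1 hcF) hc0
  have hfix : ∀ f : A →ₗ[k] k, contractRight A f (comul c) = f 1 • c := by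
    intro f
    by_contra hne
    refine hmin n (Nat.lt_succ_self n) ⟨contractRight A f (comul c) - f 1 • c, ?_,
      sub_ne_zero.2 hne, ?_⟩
    · exact W.sub_mem (contractRight_mem_of_mem_range_rTensor W (hW c hcW) f)
        (W.smul_mem _ hcW)
    · have := contractRight_mem_of_mem_range_rTensor (F n) (hFtriv n c hcF) f
      rwa [map_sub, contractRight_tmul] at this
  -- Applying the counit to the invariance relation shows that an invariant element is a multiple of
  -- `1`.
  have hc : c = counit (R := k) c • (1 : A) := by
    refine eq_of_forall_functional_eq (k := k) fun f => ?_
    rw [← counit_dual_smul (toConv f) c, dual_smul_def, hfix, map_smul, map_smul, smul_eq_mul,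
      smul_eq_mul, mul_comm]
  have hcne : counit (R := k) c ≠ 0 := fun h0 => hc0 (by rw [hc, h0, zero_smul])
  rw [show (1 : A) = (counit (R := k) c)⁻¹ • c by
    conv_rhs => rw [hc]
    rw [map_smul, Bialgebra.counit_one, smul_eq_mul, mul_one, inv_smul_smul₀ hcne]]
  exact W.smul_mem _ hcW

theorem IsSubcoalgebra.isStable {W : Submodule k A} (hW : IsSubcoalgebra W) :
    (regularRep k A).IsStable W := by
  intro w hw
  obtain ⟨y, hy⟩ := hW w hw
  refine ⟨W.subtype.lTensor W y, ?_⟩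
  rw [← LinearMap.comp_apply, LinearMap.rTensor_comp_lTensor, hy]
  rfl

theorem isSubcoalgebra_span_of_isGroupLikeElem {γ : A} (hγ : IsGroupLikeElem k γ) :
    IsSubcoalgebra (Submodule.span k {γ}) := by
  intro c hc
  obtain ⟨t, rfl⟩ := Submodule.mem_span_singleton.1 hc
  have hmem : γ ∈ Submodule.span k {γ} := Submodule.mem_span_singleton_self γ
  exact ⟨t • ((⟨γ, hmem⟩ : Submodule.span k {γ}) ⊗ₜ (⟨γ, hmem⟩ : Submodule.span k {γ})), by
    rw [map_smul, map_smul, hγ.comul_eq_tmul_self]; rfl⟩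

theorem IsUnipotent.isGroupLikeElem_eq_one (h : IsUnipotent k A) {γ : A}
    (hγ : IsGroupLikeElem k γ) : γ = 1 := by
  have h1 := h.one_mem_of_isStable (isSubcoalgebra_span_of_isGroupLikeElem hγ).isStable
    (by simpa using hγ.ne_zero)
  obtain ⟨t, ht⟩ := Submodule.mem_span_singleton.1 h1
  have := congrArg (counit (R := k)) ht
  rw [map_smul, hγ.counit_eq_one, Bialgebra.counit_one, smul_eq_mul, mul_one] at this
  rw [← ht, this, one_smul]

/-- Every nonzero subcoalgebra contains `1`, so the line of `1` is the only simple one. -/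
theorem IsUnipotent.coradical_eq (h : IsUnipotent k A) :
    coradical k A = Submodule.span k {1} := by
  have hone : IsSubcoalgebra (Submodule.span k {(1 : A)}) :=
    isSubcoalgebra_span_of_isGroupLikeElem .one
  have hne : Submodule.span k {(1 : A)} ≠ ⊥ := by
    simpa using (IsGroupLikeElem.one : IsGroupLikeElem k (1 : A)).ne_zero
  have hle : ∀ C : Submodule k A, IsSubcoalgebra C → C ≠ ⊥ → Submodule.span k {1} ≤ C :=
    fun C hC hC0 => (Submodule.span_singleton_le_iff_mem _ _).2
      (h.one_mem_of_isStable hC.isStable hC0)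
  apply le_antisymm
  · refine sSup_le fun C hC => ?_
    rcases hC.2.2 _ (hle C hC.1 hC.2.1) hone with h0 | h0
    · exact absurd h0 hne
    · exact h0.ge
  · refine le_sSup ⟨hone, hne, fun C hC hsub => ?_⟩
    by_cases hC0 : C = ⊥
    · exact Or.inl hC0
    · exact Or.inr (le_antisymm hC (hle C hsub hC0))

/-! ### The radical of a unipotent group and the annihilator of its square -/

theorem IsUnipotent.mem_radical_iff (h : IsUnipotent k A) {B : Type u} [CommRing B] [Algebra k B]
    {w : A →ₗ[k] B} : w ∈ radical k A B ↔ w 1 = 0 := by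
  rw [radical, h.coradical_eq]
  constructor
  · exact fun hw => hw 1 (Submodule.mem_span_singleton_self 1)
  · intro hw a ha
    obtain ⟨t, rfl⟩ := Submodule.mem_span_singleton.1 ha
    rw [map_smul, hw, smul_zero]

theorem IsUnipotent.primitives_le_radicalSqPerp (h : IsUnipotent k A) :
    primitives k A ≤ radicalSqPerp k A := by
  intro p hp B _ _ w hw w' hw'
  rw [h.mem_radical_iff] at hw hw'
  rw [convMul_apply_of_mem_primitives _ _ hp]
  simp [hw, hw']

/-- Products of `k`-points suffice: for functionals `f` and `g` corrected to vanish at `1`, the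
vanishing of their product at `a` is the primitivity equation tested against `g` and `f`. -/
theorem IsUnipotent.sub_counit_mem_primitives (h : IsUnipotent k A) {a : A}
    (ha : a ∈ radicalSqPerp k A) :
    a - counit (R := k) a • (1 : A) ∈ primitives k A := by
  rw [mem_primitives, ← sub_eq_zero]
  refine eq_zero_of_contractRight_eq_zero _ fun f => eq_of_forall_functional_eq (k := k) fun g => ?_
  have key : ((toConv g - algebraMap k _ (g 1)) * (toConv f - algebraMap k _ (f 1)) :
      WithConv (A →ₗ[k] k)) a = 0 := by
    refine ha k (g - (algebraMap k (WithConv (A →ₗ[k] k)) (g 1)).ofConv) ?_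
      (f - (algebraMap k (WithConv (A →ₗ[k] k)) (f 1)).ofConv) ?_ <;>
    · rw [h.mem_radical_iff]
      simp
  have hexp : ((toConv g - algebraMap k _ (g 1)) * (toConv f - algebraMap k _ (f 1)) :
      WithConv (A →ₗ[k] k)) = toConv g * toConv f - f 1 • toConv g - g 1 • toConv f +
        (f 1 * g 1) • 1 := by
    rw [sub_mul, mul_sub, mul_sub, ← Algebra.commutes, ← Algebra.smul_def, ← Algebra.smul_def,
      ← map_mul, Algebra.algebraMap_eq_smul_one, mul_comm (g 1)]
    abel
  rw [hexp] at key
  have hkey : (toConv g * toConv f) a - f 1 * g a - g 1 * f a +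
      f 1 * g 1 * counit (R := k) a = 0 := key
  have hcomul : g (contractRight A f (comul a)) = (toConv g * toConv f) a :=
    functional_contractRight_comul (toConv g) (toConv f) a
  simp only [map_sub, map_add, map_smul, contractRight_tmul, hcomul, Bialgebra.comul_one,
    Algebra.TensorProduct.one_def, smul_eq_mul, map_zero]
  linear_combination hkey

end Unipotent

/-! ### The structure of abelian affine groups -/

section Structure

variable {k : Type u} [Field k] {A : Type u} [CommRing A] [HopfAlgebra k A]

theorem algHom_convMul_apply_of_mem_primitives {B : Type u} [CommRing B] [Algebra k B]
    (f g : WithConv (A →ₐ[k] B)) {p : A} (hp : p ∈ primitives k A) :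
    (f * g).ofConv p = f.ofConv p + g.ofConv p := by
  have := convMul_apply_of_mem_primitives (toConv f.ofConv.toLinearMap)
    (toConv g.ofConv.toLinearMap) hp
  refine this.trans ?_
  simp

/-- A natural family of bijective group homomorphisms is an isomorphism of functors. -/
def GroupFunctor.isoOfBijective {F G : GroupFunctor k}
    (η : ∀ B, F.obj B →* G.obj B) (hη : ∀ B, Function.Bijective (η B))
    (nat : ∀ {B C : CommAlgCat.{u} k} (φ : B ⟶ C) (x : F.obj B),
      η C ((F.map φ).hom x) = (G.map φ).hom (η B x)) : F ≅ G :=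
  NatIso.ofComponents (fun B => (MulEquiv.ofBijective (η B) (hη B)).toGrpIso) fun φ => by
    apply GrpCat.hom_ext
    apply MonoidHom.ext
    exact nat φ

variable (k A) in
/-- Evaluation of points of `Spec A` on a family of primitive elements. -/
def primitiveValues {X : Type u} (b : X → primitives k A) (B : CommAlgCat.{u} k) :
    (specGroup k A).obj B →* (piGroup fun _ : X => additiveGroup k).obj B :=
  letI := pointsGroup k A B
  MonoidHom.mk' (fun f x => Multiplicative.ofAdd ((WithConv.ofConv f : A →ₐ[k] B) (b x).1))
    fun f g => funext fun x => congrArg Multiplicative.ofAdd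
      (algHom_convMul_apply_of_mem_primitives f g (b x).2)

variable (k A) in
/-- Restriction of points of `Spec A` along a bialgebra map. -/
def specGroupComap {R : Type u} [CommRing R] [HopfAlgebra k R] (ι : R →ₐc[k] A)
    (B : CommAlgCat.{u} k) : (specGroup k A).obj B →* (specGroup k R).obj B :=
  letI := pointsGroup k A B
  letI := pointsGroup k R B
  MonoidHom.mk' (fun f => WithConv.toConv ((WithConv.ofConv f : A →ₐ[k] B).comp (ι : R →ₐ[k] A)))
    fun f g => WithConv.ext (AlgHom.convMul_comp_bialgHom_distrib f g ι)

variable [IsCocomm k A] [IsAlgClosed k] [CharZero k]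

variable (k A) in
-- A `B`-point amounts to a linear map on the primitives, given freely on a basis, together with a
-- `B`-point of `Spec k[Γ]`.
theorem nonempty_specGroup_iso :
    Nonempty (specGroup k A ≅ prodGroup
      (piGroup fun _ : Module.Basis.ofVectorSpaceIndex k (primitives k A) => additiveGroup k)
      (specGroup k (MonoidAlgebra k (GroupLike k A)))) := by
  let b := Module.Basis.ofVectorSpace k (primitives k A)
  refine ⟨GroupFunctor.isoOfBijective (fun B => (primitiveValues k A b B).prod
    (specGroupComap k A (groupLikeInclusion k A) B)) (fun B => ⟨?_, ?_⟩) fun φ x => rfl⟩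
  · rintro ⟨g⟩ ⟨g'⟩ h
    refine congrArg WithConv.toConv (algHom_ext_of_primitives_of_groupLike ?_ fun γ => ?_)
    · have hP : g.toLinearMap ∘ₗ (primitives k A).subtype =
          g'.toLinearMap ∘ₗ (primitives k A).subtype :=
        b.ext fun x => congrArg Multiplicative.toAdd (congrFun (congrArg Prod.fst h) x)
      exact fun p hp => LinearMap.congr_fun hP ⟨p, hp⟩
    · have hΓ : (g.comp (groupLikeInclusion k A : MonoidAlgebra k (GroupLike k A) →ₐ[k] A)) =
          g'.comp (groupLikeInclusion k A : MonoidAlgebra k (GroupLike k A) →ₐ[k] A) :=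
        congrArg WithConv.ofConv (congrArg Prod.snd h)
      rw [← groupLikeInclusion_single]
      exact AlgHom.congr_fun hΓ _
  · rintro ⟨y, ⟨χ⟩⟩
    obtain ⟨g, hgP, hgΓ⟩ := exists_algHom_of_primitives_of_groupLike
      (b.constr k (M' := B) fun x => Multiplicative.toAdd (α := B) (y x)) χ
    refine ⟨WithConv.toConv g, Prod.ext (funext fun x => ?_) (congrArg WithConv.toConv ?_)⟩
    · change Multiplicative.ofAdd (g (b x)) = y x
      rw [hgP, b.constr_basis]
      rfl
    · refine MonoidAlgebra.algHom_ext' (MonoidHom.ext fun γ => ?_) (by ext)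
      change g (groupLikeInclusion k A (MonoidAlgebra.single γ 1)) =
        χ (MonoidAlgebra.single γ 1)
      rw [groupLikeInclusion_single, hgΓ]

/-! ### Points of a unipotent group and the quotient `I*/I*²` -/

theorem IsUnipotent.algHom_ext (h : IsUnipotent k A) {B : Type u} [CommRing B] [Algebra k B]
    {g g' : A →ₐ[k] B} (hP : ∀ p ∈ primitives k A, g p = g' p) : g = g' :=
  algHom_ext_of_primitives_of_groupLike hP fun γ => by
    rw [h.isGroupLikeElem_eq_one γ.2, map_one, map_one]

theorem exists_algHom_of_primitives {B : Type u} [CommRing B] [Algebra k B]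
    (l : primitives k A →ₗ[k] B) : ∃ g : A →ₐ[k] B, ∀ p : primitives k A, g p = l p := by
  obtain ⟨g, hg, -⟩ := exists_algHom_of_primitives_of_groupLike l
    -- The counit is the default choice for the group-like part.
    ((Algebra.ofId k B).comp (Bialgebra.counitAlgHom k _))
  exact ⟨g, hg⟩

theorem IsUnipotent.nonempty_specGroup_iso (h : IsUnipotent k A) :
    Nonempty (specGroup k A ≅
      piGroup fun _ : Module.Basis.ofVectorSpaceIndex k (primitives k A) => additiveGroup k) := by
  let b := Module.Basis.ofVectorSpace k (primitives k A)
  refine ⟨GroupFunctor.isoOfBijective (primitiveValues k A b) (fun B => ⟨?_, fun y => ?_⟩)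
    fun φ x => rfl⟩
  · rintro ⟨g⟩ ⟨g'⟩ hg
    have hP : g.toLinearMap ∘ₗ (primitives k A).subtype =
        g'.toLinearMap ∘ₗ (primitives k A).subtype :=
      b.ext fun x => congrArg Multiplicative.toAdd (congrFun hg x)
    exact congrArg WithConv.toConv (h.algHom_ext fun p hp => LinearMap.congr_fun hP ⟨p, hp⟩)
  · obtain ⟨g, hg⟩ := exists_algHom_of_primitives
      (b.constr k (M' := B) fun x => Multiplicative.toAdd (α := B) (y x))
    refine ⟨WithConv.toConv g, funext fun x => ?_⟩
    change Multiplicative.ofAdd (g (b x)) = y x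
    rw [hg, b.constr_basis]
    rfl

theorem IsUnipotent.sub_one_mem_radical (h : IsUnipotent k A) {B : Type u} [CommRing B]
    [Algebra k B] (g : A →ₐ[k] B) :
    g.toLinearMap - (1 : WithConv (A →ₗ[k] B)).ofConv ∈ radical k A B := by
  rw [h.mem_radical_iff]
  simp

/-- From `fg - 1 = (f - 1) + (g - 1) + (f - 1)(g - 1)`, whose last term lies in `I*²`. -/
theorem IsUnipotent.mk_convMul_sub_one (h : IsUnipotent k A) {B : Type u} [CommRing B]
    [Algebra k B] (f g : WithConv (A →ₐ[k] B)) :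
    (QuotientAddGroup.mk ⟨(f * g).ofConv.toLinearMap - (1 : WithConv (A →ₗ[k] B)).ofConv,
      h.sub_one_mem_radical _⟩ : Cotangent k A B) =
    QuotientAddGroup.mk ⟨f.ofConv.toLinearMap - (1 : WithConv (A →ₗ[k] B)).ofConv,
      h.sub_one_mem_radical _⟩ +
    QuotientAddGroup.mk ⟨g.ofConv.toLinearMap - (1 : WithConv (A →ₗ[k] B)).ofConv,
      h.sub_one_mem_radical _⟩ := by
  rw [← QuotientAddGroup.mk_add, eq_comm, QuotientAddGroup.eq]
  intro a ha
  have key := ha B _ (h.sub_one_mem_radical f.ofConv) _ (h.sub_one_mem_radical g.ofConv)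
  rw [toConv_sub, toConv_sub, toConv_ofConv, sub_mul, mul_sub, one_mul, mul_one] at key
  refine Eq.trans ?_ key
  change -((f.ofConv a - (1 : WithConv (A →ₗ[k] B)) a) +
      (g.ofConv a - (1 : WithConv (A →ₗ[k] B)) a)) +
    ((toConv f.ofConv.toLinearMap * toConv g.ofConv.toLinearMap) a -
      (1 : WithConv (A →ₗ[k] B)) a) =
    (toConv f.ofConv.toLinearMap * toConv g.ofConv.toLinearMap) a - f.ofConv a -
      (g.ofConv a - (1 : WithConv (A →ₗ[k] B)) a)
  ring

/-- The homomorphism `g ↦ g - 1` from the points of a unipotent group to `I*/I*²`. -/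
def IsUnipotent.toCotangent (h : IsUnipotent k A) (B : CommAlgCat.{u} k) :
    (specGroup k A).obj B →* (cotangentGroup k A).obj B :=
  letI := pointsGroup k A B
  MonoidHom.mk' (fun f => Multiplicative.ofAdd (QuotientAddGroup.mk
    ⟨(WithConv.ofConv f : A →ₐ[k] B).toLinearMap - (1 : WithConv (A →ₗ[k] B)).ofConv,
      h.sub_one_mem_radical _⟩)) fun f g => by
    exact congrArg Multiplicative.ofAdd (h.mk_convMul_sub_one f g)

theorem IsUnipotent.toCotangent_naturality (h : IsUnipotent k A) {B C : CommAlgCat.{u} k}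
    (φ : B ⟶ C) (x : (specGroup k A).obj B) :
    h.toCotangent C (((specGroup k A).map φ).hom x) =
      ((cotangentGroup k A).map φ).hom (h.toCotangent B x) := by
  refine congrArg Multiplicative.ofAdd (congrArg QuotientAddGroup.mk (Subtype.ext ?_))
  ext a
  change φ.hom _ - algebraMap k C _ = φ.hom (_ - algebraMap k B _)
  rw [map_sub, AlgHom.commutes]
  rfl

/-- Because `I*²` is orthogonal to `k ⊕ P`, a class in `I*/I*²` is known from its restriction to the
primitives, where `g - 1` agrees with `g`; those values determine `g` and can be prescribed. -/
theorem IsUnipotent.bijective_toCotangent (h : IsUnipotent k A) (B : CommAlgCat.{u} k) :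
    Function.Bijective (h.toCotangent B) := by
  constructor
  · rintro ⟨g⟩ ⟨g'⟩ hg
    have hmem := QuotientAddGroup.eq.1 (congrArg Multiplicative.toAdd hg)
    refine congrArg WithConv.toConv (h.algHom_ext fun p hp => ?_)
    have hp0 : -(g p - algebraMap k B (counit (R := k) p)) +
        (g' p - algebraMap k B (counit (R := k) p)) = 0 :=
      hmem p (h.primitives_le_radicalSqPerp hp)
    linear_combination -hp0
  · intro x
    obtain ⟨⟨w, hw⟩, hx⟩ := QuotientAddGroup.mk_surjective (Multiplicative.toAdd x)
    obtain ⟨g, hg⟩ := exists_algHom_of_primitives (w ∘ₗ (primitives k A).subtype)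
    refine ⟨WithConv.toConv g, congrArg Multiplicative.ofAdd (Eq.trans ?_ hx)⟩
    refine QuotientAddGroup.eq.2 fun a ha => ?_
    have hp := h.sub_counit_mem_primitives ha
    have hgp : g (a - counit (R := k) a • (1 : A)) = w (a - counit (R := k) a • (1 : A)) :=
      hg ⟨_, hp⟩
    have hw1 : w 1 = 0 := h.mem_radical_iff.1 hw
    rw [map_sub, map_sub, map_smul, map_smul, hw1, map_one, smul_zero, sub_zero,
      ← Algebra.algebraMap_eq_smul_one] at hgp
    change -(g a - algebraMap k B (counit (R := k) a)) + w a = 0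
    rw [hgp, neg_add_cancel]

end Structure

end AffineAbelianGroup

end

theorem mainTheorem8 (k : Type u) [Field k] [IsAlgClosed k] [CharZero k]
    (A : Type u) [CommRing A] [HopfAlgebra k A] [Coalgebra.IsCocomm k A] :
    (∃ (X : Type u) (R : Type u) (_ : CommRing R) (_ : HopfAlgebra k R),
      AffineAbelianGroup.IsDiagonalizable k R ∧
      Nonempty (AffineAbelianGroup.specGroup k A ≅
        AffineAbelianGroup.prodGroup (AffineAbelianGroup.piGroup fun _ : X => AffineAbelianGroup.additiveGroup k) (AffineAbelianGroup.specGroup k R))) ∧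
    (AffineAbelianGroup.IsUnipotent k A →
      (∃ e : AffineAbelianGroup.specGroup k A ≅ AffineAbelianGroup.cotangentGroup k A,
        ∀ (B : Type u) [CommRing B] [Algebra k B] (g : A →ₐ[k] B),
          ∃ h : g.toLinearMap - (1 : WithConv (A →ₗ[k] B)).ofConv ∈ AffineAbelianGroup.radical k A B,
            (e.hom.app (CommAlgCat.of k B)).hom (WithConv.toConv g) =
              Multiplicative.ofAdd (QuotientAddGroup.mk
                ⟨g.toLinearMap - (1 : WithConv (A →ₗ[k] B)).ofConv, h⟩)) ∧
      ∃ X : Type u, Nonempty (AffineAbelianGroup.cotangentGroup k A ≅ AffineAbelianGroup.piGroup fun _ : X => AffineAbelianGroup.additiveGroup k)) := by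
  refine ⟨⟨_, _, inferInstance, inferInstance,
    AffineAbelianGroup.isDiagonalizable_groupAlgebra k (GroupLike k A),
    AffineAbelianGroup.nonempty_specGroup_iso k A⟩, fun h => ?_⟩
  let e : AffineAbelianGroup.specGroup k A ≅ AffineAbelianGroup.cotangentGroup k A :=
    AffineAbelianGroup.GroupFunctor.isoOfBijective h.toCotangent h.bijective_toCotangent
      fun {B C} φ x => h.toCotangent_naturality φ x
  obtain ⟨e'⟩ := h.nonempty_specGroup_iso
  exact ⟨⟨e, fun B _ _ g => ⟨h.sub_one_mem_radical g, rfl⟩⟩, _, ⟨e.symm ≪≫ e'⟩⟩
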